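/- Let $d\in\mathbb N$, $r>d/2$, $0<\delta\le 2$ and $\varepsilon>0$, and let $\mathbb T^d=(\mathbb R/2\pi\mathbb Z)^d$. For a periodic distribution $u=\sum_{k\in\mathbb Z^d}\hat u_k e^{ik\cdot x}$ on $\mathbb T^d$ put $\|u\|_s^2=\sum_{k}(1+|k|^2)^s|\hat u_k|^2$. For $c>0$ let $\langle\nabla\rangle_c=\sqrt{-\Delta+c^2}$ and $\mathcal A_c=c\langle\nabla\rangle_c-c^2$ (Fourier multipliers on $\mathbb T^d$, with $-\Delta$ having symbol $|k|^2$), and let $\varphi_1(z)=\int_0^1 e^{(1-\theta)z}\,d\theta$. *First-order scheme.* For initial data $z(0)$, $z'(0)=\partial_tz(0)$ of the Klein–Gordon equation $c^{-2}\partial_{tt}z-\Delta z+c^2z=|z|^2z$ on $\mathbb T^d$, a step size $\tau>0$ and $t_n=n\tau$, let $$u_*^0=z(0)-ic^{-1}\langle\nabla\rangle_c^{-1}z'(0),\qquad v_*^0=\overline{z(0)}-ic^{-1}\langle\nabla\rangle_c^{-1}\overline{z'(0)},$$ $$\begin{aligned}u_*^{n+1}&=e^{i\tau\mathcal A_c}e^{-\frac{i\tau}{8}(|u_*^n|^2+2|v_*^n|^2)}u_*^n-\tfrac{i\tau}{8}\big(c\langle\nabla\rangle_c^{-1}-1\big)e^{i\tau\mathcal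 A_c}\big(|u_*^n|^2+2|v_*^n|^2\big)u_*^n\\&\quad-\tfrac{i\tau}{8}c\langle\nabla\rangle_c^{-1}e^{i\tau\mathcal A_c}\Big\{e^{2ic^2t_n}\varphi_1(2ic^2\tau)(u_*^n)^2v_*^n+e^{-2ic^2t_n}\varphi_1(-2ic^2\tau)\big(2|u_*^n|^2+|v_*^n|^2\big)\overline{v_*^n}\\&\qquad\qquad+e^{-4ic^2t_n}\varphi_1(-4ic^2\tau)(\overline{v_*^n})^2\,\overline{u_*^n}\Big\},\end{aligned}$$ and let $v_*^{n+1}$ be given by the same formula with $u_*^n$ and $v_*^n$ exchanged. *Lie splitting.* For limit data $\gamma,\varphi$ let $u_{*,\infty}^0=\gamma-i\varphi$, $v_{*,\infty}^0=\overline\gamma-i\overline\varphi$ and $$u_{*,\infty}^{n+1}=e^{-i\tau\Delta/2}e^{-\frac{i\tau}{8}(|u_{*,\infty}^n|^2+2|v_{*,\infty}^n|^2)}u_{*,\infty}^n,\qquad v_{*,\infty}^{n+1}=e^{-i\tau\Delta/2}e^{-\frac{i\tau}{8}(|v_{*,\infty}^n|^2+2|u_{*,\infty}^n|^2)}v_{*,\infty}^n;$$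 this is the Lie splitting of the limit system $i\partial_tu=\frac12\Delta u+\frac18(|u|^2+2|v|^2)u$, $i\partial_tv=\frac12\Delta v+\frac18(|v|^2+2|u|^2)v$. **Claim.** For all $M,K$ there are $T>0$, $\tau_0>0$ and $C$, depending only on $d,r,\delta,\varepsilon,M,K$, such that the following holds for every $c>0$. If $$\|z(0)\|_{r+2\delta+\varepsilon}+\|c^{-1}\langle\nabla\rangle_c^{-1}z'(0)\|_{r+2\delta+\varepsilon}\le M\quad\text{and}\quad\|z(0)-\gamma\|_r+\|c^{-1}\langle\nabla\rangle_c^{-1}z'(0)-\varphi\|_r\le Kc^{-\delta},$$ then for all $0<\tau\le\tau_0$ with $\tau c^{2-\delta}\ge1$ and all $n\ge0$ with $t_n\le T$, $$\|u_*^n-u_{*,\infty}^n\|_r+\|v_*^n-v_{*,\infty}^n\|_r\le C\,c^{-\delta}.$$ -/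

import Mathlib

open scoped ENNReal

noncomputable section

namespace KleinGordon

/-- A periodic distribution `∑ₖ aₖ e^{i k·x}` on the torus `(ℝ/2πℤ)^d`, given by its Fourier
coefficients `aₖ`, `k ∈ ℤ^d`. Only those with a finite Sobolev norm (of some order) are used. -/
abbrev PerDist (d : ℕ) : Type := (Fin d → ℤ) → ℂ

variable {d : ℕ}

/-- `|k|² = k₁² + ⋯ + k_d²`. -/
def freqSq (k : Fin d → ℤ) : ℝ := ∑ j, (k j : ℝ) ^ 2

/-- The Sobolev norm `‖a‖_s = (∑ₖ (1 + |k|²)^s |aₖ|²)^{1/2}`, with value `∞` outside `H^s`. -/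
def sobolevNorm (s : ℝ) (a : PerDist d) : ℝ≥0∞ :=
  (∑' k, ENNReal.ofReal ((1 + freqSq k) ^ s * ‖a k‖ ^ 2)) ^ (1 / 2 : ℝ)

/-- The function `x ↦ ∑ₖ aₖ e^{i k·x}`. The series converges absolutely for `a ∈ H^s`, `s > d/2`.
The torus `(ℝ/2πℤ)^d` is parametrized by `x = 2π y`, `y ∈ (ℝ/ℤ)^d`, so that `mFourier k y` is
`e^{i k·x}`. -/
def toFun (a : PerDist d) (y : UnitAddTorus (Fin d)) : ℂ :=
  ∑' k, a k * UnitAddTorus.mFourier k y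

/-- The Fourier coefficients `(2π)^{-d} ∫ f(x) e^{-i k·x} dx` of a function on the torus. -/
def ofFun (f : UnitAddTorus (Fin d) → ℂ) : PerDist d :=
  fun k => UnitAddTorus.mFourierCoeff f k

/-- The complex conjugate of a distribution. -/
def conjDist (a : PerDist d) : PerDist d := fun k => (starRingEnd ℂ) (a (-k))

/-- The Fourier multiplier with symbol `m`. -/
def multiplier (m : (Fin d → ℤ) → ℂ) (a : PerDist d) : PerDist d := fun k => m k * a k

/-- The symbol `√(|k|² + c²)` of `⟨∇⟩_c = √(-Δ + c²)`. -/
def bracket (c : ℝ) (k : Fin d → ℤ) : ℝ := Real.sqrt (freqSq k + c ^ 2)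

/-- The symbol of `𝒜_c = c⟨∇⟩_c - c²`. -/
def symbolA (c : ℝ) (k : Fin d → ℤ) : ℝ := c * bracket c k - c ^ 2

/-- The operator `c⁻¹⟨∇⟩_c⁻¹`. -/
def invCBracket (c : ℝ) : PerDist d → PerDist d :=
  multiplier fun k => ((c⁻¹ * (bracket c k)⁻¹ : ℝ) : ℂ)

/-- The symbol of `c⟨∇⟩_c⁻¹`. -/
def symbolB (c : ℝ) (k : Fin d → ℤ) : ℂ := ((c * (bracket c k)⁻¹ : ℝ) : ℂ)

/-- The symbol of `e^{iτ𝒜_c}`. -/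
def symbolExpA (c τ : ℝ) (k : Fin d → ℤ) : ℂ :=
  Complex.exp (Complex.I * ((τ * symbolA c k : ℝ) : ℂ))

/-- The symbol of `e^{-iτΔ/2}`, the symbol of `Δ` being `-|k|²`. -/
def symbolExpLaplace (τ : ℝ) (k : Fin d → ℤ) : ℂ :=
  Complex.exp (-Complex.I * (τ : ℂ) * (((-freqSq k) / 2 : ℝ) : ℂ))

/-- `φ₁(z) = ∫₀¹ e^{(1-θ)z} dθ`. -/
def phiOne (z : ℂ) : ℂ := ∫ θ in (0 : ℝ)..1, Complex.exp ((1 - (θ : ℂ)) * z)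

/-- `(|u|² + 2|v|²)` for functions `u`, `v` on the torus. -/
def potential (u v : UnitAddTorus (Fin d) → ℂ) (y : UnitAddTorus (Fin d)) : ℂ :=
  ((‖u y‖ ^ 2 + 2 * ‖v y‖ ^ 2 : ℝ) : ℂ)

/-- The nonlinear substep `e^{-iτ(|u|² + 2|v|²)/8} u`. -/
def phaseStep (τ : ℝ) (u v : PerDist d) : PerDist d :=
  ofFun fun y =>
    Complex.exp (-(τ : ℂ) * (Complex.I / 8) * potential (toFun u) (toFun v) y) * toFun u y

/-- The oscillatory terms
`e^{2ic²t} φ₁(2ic²τ) u²v + e^{-2ic²t} φ₁(-2ic²τ) (2|u|² + |v|²) v̄ + e^{-4ic²t} φ₁(-4ic²τ) v̄²ū`. -/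
def oscillatory (c τ t : ℝ) (u v : PerDist d) : PerDist d :=
  ofFun fun y =>
    Complex.exp (2 * Complex.I * c ^ 2 * t) * phiOne (2 * Complex.I * c ^ 2 * τ)
        * (toFun u y ^ 2 * toFun v y)
      + Complex.exp (-2 * Complex.I * c ^ 2 * t) * phiOne (-2 * Complex.I * c ^ 2 * τ)
        * (((2 * ‖toFun u y‖ ^ 2 + ‖toFun v y‖ ^ 2 : ℝ) : ℂ) * (starRingEnd ℂ) (toFun v y))
      + Complex.exp (-4 * Complex.I * c ^ 2 * t) * phiOne (-4 * Complex.I * c ^ 2 * τ)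
        * ((starRingEnd ℂ) (toFun v y) ^ 2 * (starRingEnd ℂ) (toFun u y))

/-- One step, from time `t` to `t + τ`, of the first-order exponential-type scheme in the first
component; the second component is obtained by exchanging `u` and `v`. -/
def schemeStep (c τ t : ℝ) (u v : PerDist d) : PerDist d :=
  multiplier (symbolExpA c τ) (phaseStep τ u v)
    - ((τ : ℂ) * (Complex.I / 8)) •
        multiplier (fun k => (symbolB c k - 1) * symbolExpA c τ k)
          (ofFun fun y => potential (toFun u) (toFun v) y * toFun u y)
    - ((τ : ℂ) * (Complex.I / 8)) •
        multiplier (fun k => symbolB c k * symbolExpA c τ k) (oscillatory c τ t u v)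

/-- The iterates `(u_*ⁿ, v_*ⁿ)` of the first-order scheme for the data `z(0) = z0` and
`∂ₜz(0) = z1`, where `tₙ = nτ`. -/
def scheme (c τ : ℝ) (z0 z1 : PerDist d) : ℕ → PerDist d × PerDist d
  | 0 => (z0 - Complex.I • invCBracket c z1,
      conjDist z0 - Complex.I • invCBracket c (conjDist z1))
  | n + 1 =>
      let w := scheme c τ z0 z1 n
      (schemeStep c τ (n * τ) w.1 w.2, schemeStep c τ (n * τ) w.2 w.1)

/-- One step of the Lie splitting for the Schrödinger limit system in the first component. -/
def lieStep (τ : ℝ) (u v : PerDist d) : PerDist d :=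
  multiplier (symbolExpLaplace τ) (phaseStep τ u v)

/-- The iterates `(u_{*,∞}ⁿ, v_{*,∞}ⁿ)` of the Lie splitting, where `γ` is the limit of `z(0)` and
`φ` the limit of `c⁻¹⟨∇⟩_c⁻¹ ∂ₜz(0)`. -/
def lie (τ : ℝ) (γ φ : PerDist d) : ℕ → PerDist d × PerDist d
  | 0 => (γ - Complex.I • φ, conjDist γ - Complex.I • conjDist φ)
  | n + 1 =>
      let w := lie τ γ φ n
      (lieStep τ w.1 w.2, lieStep τ w.2 w.1)

end KleinGordon

end

/-! ### Weighted sequence inequalities and Sobolev weights -/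

open scoped ENNReal

noncomputable section

namespace KleinGordon

variable {d : ℕ}

/-! Both methods have the form `x (n+1) = E (x n + g n)`: a Fourier multiplier of modulus one,
applied to the iterate plus an increment of size `O(τ)`. Unrolling with Duhamel's formula
(`duhamel`, `norm_sub_le_of_recursion`) leaves three sources of error. Propagators: the powers of
`e^{iτ𝒜_c}` and `e^{-iτΔ/2}` are compared directly at times at most `1`. Their symbols differ by at
most `2` and by at most `|k|⁴/c²`, hence, interpolating, by `2c^{-δ}(1+|k|²)^δ`. This costs `2δ`
derivatives (`norm_prop_pow_sub_le`). Acting on increments of size `O(τ)`, the errors sum to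
`O(c^{-δ})`. Increments: the phase parts differ by `τ` times a Lipschitz constant times the current
error. The correction with symbol `c⟨∇⟩_c⁻¹ - 1` is `O(τc^{-δ})` at the same cost in derivatives. In
the oscillatory terms `φ₁` is `O(1/(c²τ))`, which is `O(c^{-δ})` exactly because `τc^{2-δ} ≥ 1`
(`norm_oscCoeff_le`). Data: their difference is `O(c^{-δ})` by assumption. A short-time Gronwall
argument closes the estimate (`error_le`). The lost derivatives are paid by running the scheme also
in `H^ρ`, `ρ = r + 2δ + ε`, where it stays bounded for a uniform time; the Lie splitting is needed
in `H^r` only. The nonlinear bounds use that `H^s`, `s > d/2`, is a commutative Banach algebra. It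
is built as `Sob d s`, with the norm rescaled to be submultiplicative; its algebraic exponential is
the pointwise one (`toC_exp`). -/

lemma ennreal_rpow_half_sq (x : ℝ≥0∞) : (x ^ (1 / 2 : ℝ)) ^ 2 = x := by
  rw [← ENNReal.rpow_two, ← ENNReal.rpow_mul]
  norm_num

/-- Cauchy–Schwarz, as Hölder's inequality for the counting measure. -/
lemma ennreal_tsum_mul_sq_le {ι : Type*} [Countable ι] (f g : ι → ℝ≥0∞) :
    (∑' i, f i * g i) ^ 2 ≤ (∑' i, f i ^ 2) * ∑' i, g i ^ 2 := by
  let _ : MeasurableSpace ι := ⊤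
  have h := ENNReal.lintegral_mul_le_Lp_mul_Lq (MeasureTheory.Measure.count (α := ι))
    (p := 2) (q := 2) ⟨by norm_num, by norm_num, by norm_num⟩
    (f := f) (g := g) (Measurable.of_discrete).aemeasurable (Measurable.of_discrete).aemeasurable
  simp only [MeasureTheory.lintegral_count, Pi.mul_apply] at h
  calc (∑' i, f i * g i) ^ 2
      ≤ ((∑' i, f i ^ (2 : ℝ)) ^ (1 / 2 : ℝ) * (∑' i, g i ^ (2 : ℝ)) ^ (1 / 2 : ℝ)) ^ 2 := by
        gcongr
    _ = _ := by
        simp only [ENNReal.rpow_two, mul_pow, ennreal_rpow_half_sq]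

/-- Inserting `W j` and `W (k - j)` with their inverses and applying Cauchy–Schwarz in `j` isolates
the weight ratio, which `κ` bounds uniformly in `k`; exchanging the sums then factorizes the rest.
-/
lemma tsum_weighted_convolution_sq_le {G : Type*} [AddCommGroup G] [Countable G]
    (W A B : G → ℝ≥0∞) (h0 : ∀ k, W k ≠ 0) (ht : ∀ k, W k ≠ ⊤) (κ : ℝ≥0∞)
    (hκ : ∀ k, ∑' j, (W k * ((W j)⁻¹ * (W (k - j))⁻¹)) ^ 2 ≤ κ) :
    ∑' k, (W k * ∑' j, A j * B (k - j)) ^ 2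
      ≤ κ * ((∑' k, (W k * A k) ^ 2) * ∑' k, (W k * B k) ^ 2) := by
  have h1 : ∀ k, (W k * ∑' j, A j * B (k - j)) ^ 2
      ≤ κ * ∑' j, (W j * A j) ^ 2 * (W (k - j) * B (k - j)) ^ 2 := by
    intro k
    have e : W k * ∑' j, A j * B (k - j)
        = ∑' j, (W k * ((W j)⁻¹ * (W (k - j))⁻¹)) * ((W j * A j) * (W (k - j) * B (k - j))) := by
      rw [← ENNReal.tsum_mul_left]
      refine tsum_congr fun j => ?_
      have e1 : W j * (W j)⁻¹ = 1 := ENNReal.mul_inv_cancel (h0 _) (ht _)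
      have e2 : W (k - j) * (W (k - j))⁻¹ = 1 := ENNReal.mul_inv_cancel (h0 _) (ht _)
      calc W k * (A j * B (k - j))
          = W k * (A j * B (k - j)) * (W j * (W j)⁻¹) * (W (k - j) * (W (k - j))⁻¹) := by
            rw [e1, e2]; ring
        _ = _ := by ring
    rw [e]
    refine (ennreal_tsum_mul_sq_le _ _).trans ?_
    simp only [mul_pow (_ * _) (_ * _) 2]
    gcongr
    simpa only [mul_pow] using hκ k
  calc ∑' k, (W k * ∑' j, A j * B (k - j)) ^ 2
      ≤ ∑' k, κ * ∑' j, (W j * A j) ^ 2 * (W (k - j) * B (k - j)) ^ 2 := by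
        gcongr with k; exact h1 k
    _ = κ * ∑' j, ∑' k, (W j * A j) ^ 2 * (W (k - j) * B (k - j)) ^ 2 := by
        rw [ENNReal.tsum_mul_left, ENNReal.tsum_comm]
    _ = _ := by
        congr 1
        rw [← ENNReal.tsum_mul_right]
        refine tsum_congr fun j => ?_
        rw [ENNReal.tsum_mul_left, ← (Equiv.subRight j).tsum_eq (fun k => (W k * B k) ^ 2)]
        rfl

lemma freqSq_nonneg (k : Fin d → ℤ) : 0 ≤ freqSq k := Finset.sum_nonneg fun _ _ => sq_nonneg _

lemma one_add_freqSq_pos (k : Fin d → ℤ) : 0 < 1 + freqSq k := by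
  linarith [freqSq_nonneg k]

lemma freqSq_neg (k : Fin d → ℤ) : freqSq (-k) = freqSq k := by simp [freqSq]

lemma freqSq_le (k j : Fin d → ℤ) : freqSq k ≤ 2 * freqSq j + 2 * freqSq (k - j) := by
  simp only [freqSq, Finset.mul_sum, ← Finset.sum_add_distrib]
  refine Finset.sum_le_sum fun i _ => ?_
  simp only [Pi.sub_apply, Int.cast_sub]
  nlinarith [sq_nonneg ((k i : ℝ) - 2 * j i)]

/-- The Sobolev weight `(1 + |k|²)^{s/2}`. -/
def weight (s : ℝ) (k : Fin d → ℤ) : ℝ := (1 + freqSq k) ^ (s / 2)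

lemma weight_pos (s : ℝ) (k : Fin d → ℤ) : 0 < weight s k :=
  Real.rpow_pos_of_pos (one_add_freqSq_pos k) _

lemma weight_sq (s : ℝ) (k : Fin d → ℤ) : weight s k ^ 2 = (1 + freqSq k) ^ s := by
  rw [weight, ← Real.rpow_natCast, ← Real.rpow_mul (one_add_freqSq_pos k).le]
  congr 1
  push_cast; ring

lemma weight_neg (s : ℝ) (k : Fin d → ℤ) : weight s (-k) = weight s k := by
  simp [weight, freqSq_neg]

lemma sobolevNorm_eq (s : ℝ) (a : PerDist d) :
    sobolevNorm s a = (∑' k, (ENNReal.ofReal (weight s k) * ‖a k‖ₑ) ^ 2) ^ (1 / 2 : ℝ) := by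
  unfold sobolevNorm
  congr 1
  refine tsum_congr fun k => ?_
  rw [← weight_sq, ← mul_pow, ENNReal.ofReal_pow (mul_nonneg (weight_pos s k).le (norm_nonneg _)),
    ENNReal.ofReal_mul (weight_pos s k).le, ofReal_norm]

lemma sobolevNorm_sq (s : ℝ) (a : PerDist d) :
    sobolevNorm s a ^ 2 = ∑' k, (ENNReal.ofReal (weight s k) * ‖a k‖ₑ) ^ 2 := by
  rw [sobolevNorm_eq, ennreal_rpow_half_sq]

lemma ennreal_le_of_sq_le {a b : ℝ≥0∞} (h : a ^ 2 ≤ b ^ 2) : a ≤ b :=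
  (ENNReal.pow_le_pow_left_iff two_ne_zero).1 h

/-- `∑ₖ (1 + |k|²)^{-s}` converges for `s > d/2`. -/
lemma summable_one_add_freqSq_rpow {s : ℝ} (hs : (d : ℝ) / 2 < s) :
    Summable fun k : Fin d → ℤ => (1 + freqSq k) ^ (-s) := by
  -- The series is compared with the sum of `‖v‖^{-2s}` over the lattice `ℤ^d` in Euclidean space.
  let E := EuclideanSpace ℝ (Fin d)
  let b : Module.Basis (Fin d) ℝ E := (EuclideanSpace.basisFun (Fin d) ℝ).toBasis
  let Λ : Submodule ℤ E := Submodule.span ℤ (Set.range b)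
  have hrank : Module.finrank ℤ Λ = d := by
    rw [ZLattice.rank ℝ Λ]; simp [E]
  have hsum := ZLattice.summable_norm_rpow Λ (-(2 * s)) (by rw [hrank]; linarith)
  let e : (Fin d → ℤ) → Λ := fun k => ((b.restrictScalars ℤ).equivFun.symm k)
  have he : Function.Injective e := (b.restrictScalars ℤ).equivFun.symm.injective
  have hsum' := hsum.comp_injective he
  have hnorm : ∀ k, ‖e k‖ ^ 2 = freqSq k := by
    intro k
    have : ((e k : Λ) : E) = ∑ i, k i • b i := by
      simp [e, Module.Basis.equivFun_symm_apply, Module.Basis.restrictScalars_apply]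
    rw [Submodule.coe_norm, this, EuclideanSpace.norm_sq_eq]
    simp only [freqSq]
    refine Finset.sum_congr rfl fun i _ => ?_
    have : (∑ j, k j • b j : E) i = k i := by
      change (EuclideanSpace.proj i : EuclideanSpace ℝ (Fin d) →L[ℝ] ℝ) _ = _
      rw [map_sum]
      simp [b, PiLp.single_apply]
    rw [this]; simp
  refine Summable.of_norm_bounded_eventually hsum' ?_
  -- The comparison fails at `k = 0`, where the negative power of the zero norm takes the default
  -- value `0`.
  have : {k : Fin d → ℤ | k ≠ 0} ∈ Filter.cofinite := by
    simp [Filter.mem_cofinite, Set.compl_def]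
  filter_upwards [this] with k hk
  have hpos : 0 < ‖e k‖ := by
    rw [norm_pos_iff]
    intro h
    exact hk (he (h.trans (map_zero (b.restrictScalars ℤ).equivFun.symm).symm))
  have hs0 : 0 < s := lt_of_le_of_lt (by positivity) hs
  rw [Real.norm_of_nonneg (Real.rpow_nonneg (one_add_freqSq_pos k).le _)]
  simp only [Function.comp]
  rw [show -(2 * s) = (2 : ℕ) * (-s) by push_cast; ring, Real.rpow_mul (norm_nonneg _),
    Real.rpow_natCast, hnorm]
  refine Real.rpow_le_rpow_of_nonpos ?_ (by linarith) (by linarith)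
  rw [← hnorm]; positivity

lemma tsum_ofReal_weight_inv_sq_lt_top {s : ℝ} (hs : (d : ℝ) / 2 < s) :
    ∑' k : Fin d → ℤ, (ENNReal.ofReal (weight s k))⁻¹ ^ 2 < ⊤ := by
  have h : ∀ k : Fin d → ℤ, (ENNReal.ofReal (weight s k))⁻¹ ^ 2
      = ENNReal.ofReal ((1 + freqSq k) ^ (-s)) := fun k => by
    rw [← ENNReal.ofReal_inv_of_pos (weight_pos s k),
      ← ENNReal.ofReal_pow (inv_nonneg.2 (weight_pos s k).le), inv_pow, weight_sq,
      Real.rpow_neg (one_add_freqSq_pos k).le]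
  simp only [h]
  exact (summable_one_add_freqSq_rpow hs).tsum_ofReal_lt_top

/-- One of the frequencies `j`, `k - j` is comparable to `k`, so its weight absorbs `weight s k` and
the inverse square of the other remains, which is summable for `s > d/2`. -/
lemma weight_ratio_sq_le {s : ℝ} (hs : 0 ≤ s) (k j : Fin d → ℤ) :
    (weight s k * ((weight s j)⁻¹ * (weight s (k - j))⁻¹)) ^ 2
      ≤ 4 ^ s * ((weight s (k - j))⁻¹ ^ 2 + (weight s j)⁻¹ ^ 2) := by
  have hj := weight_pos s j
  have hkj := weight_pos s (k - j)
  have key : weight s k ^ 2 ≤ 4 ^ s * (weight s j ^ 2 + weight s (k - j) ^ 2) := by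
    rw [weight_sq, weight_sq, weight_sq]
    have pj := one_add_freqSq_pos j
    have pkj := one_add_freqSq_pos (k - j)
    have h1 : 1 + freqSq k ≤ 4 * max (1 + freqSq j) (1 + freqSq (k - j)) := by
      have := freqSq_le k j
      have := le_max_left (1 + freqSq j) (1 + freqSq (k - j))
      have := le_max_right (1 + freqSq j) (1 + freqSq (k - j))
      linarith
    calc (1 + freqSq k) ^ s ≤ (4 * max (1 + freqSq j) (1 + freqSq (k - j))) ^ s :=
          Real.rpow_le_rpow (one_add_freqSq_pos k).le h1 hs
      _ = 4 ^ s * (max (1 + freqSq j) (1 + freqSq (k - j))) ^ s :=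
          Real.mul_rpow (by norm_num) (pj.le.trans (le_max_left _ _))
      _ ≤ _ := by
          gcongr
          rcases max_choice (1 + freqSq j) (1 + freqSq (k - j)) with h | h <;> rw [h]
          · linarith [Real.rpow_nonneg pkj.le s]
          · linarith [Real.rpow_nonneg pj.le s]
  calc (weight s k * ((weight s j)⁻¹ * (weight s (k - j))⁻¹)) ^ 2
      = weight s k ^ 2 * ((weight s j)⁻¹ ^ 2 * (weight s (k - j))⁻¹ ^ 2) := by ring
    _ ≤ (4 ^ s * (weight s j ^ 2 + weight s (k - j) ^ 2))
          * ((weight s j)⁻¹ ^ 2 * (weight s (k - j))⁻¹ ^ 2) := by gcongr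
    _ = _ := by field_simp

/-- The Sobolev weights of order `s > d/2` satisfy the bound making `H^s` a Banach algebra. -/
lemma exists_weight_const {s : ℝ} (hs : (d : ℝ) / 2 < s) :
    ∃ κ : ℝ, 0 < κ ∧ ∀ k : Fin d → ℤ, ∑' j, (ENNReal.ofReal (weight s k)
      * ((ENNReal.ofReal (weight s j))⁻¹ * (ENNReal.ofReal (weight s (k - j)))⁻¹)) ^ 2
        ≤ ENNReal.ofReal κ ^ 2 := by
  have hs0 : 0 ≤ s := le_of_lt (lt_of_le_of_lt (by positivity) hs)
  set S := ∑' k : Fin d → ℤ, (ENNReal.ofReal (weight s k))⁻¹ ^ 2 with hS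
  have hSt : S < ⊤ := tsum_ofReal_weight_inv_sq_lt_top hs
  have hb : ∀ k : Fin d → ℤ, ∑' j, (ENNReal.ofReal (weight s k)
      * ((ENNReal.ofReal (weight s j))⁻¹ * (ENNReal.ofReal (weight s (k - j)))⁻¹)) ^ 2
        ≤ ENNReal.ofReal (4 ^ s) * (S + S) := by
    intro k
    have h1 : ∀ j, (ENNReal.ofReal (weight s k)
      * ((ENNReal.ofReal (weight s j))⁻¹ * (ENNReal.ofReal (weight s (k - j)))⁻¹)) ^ 2
        ≤ ENNReal.ofReal (4 ^ s) * ((ENNReal.ofReal (weight s (k - j)))⁻¹ ^ 2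
          + (ENNReal.ofReal (weight s j))⁻¹ ^ 2) := by
      intro j
      have hk := weight_pos s k
      have hj := weight_pos s j
      have hkj := weight_pos s (k - j)
      rw [← ENNReal.ofReal_inv_of_pos hj, ← ENNReal.ofReal_inv_of_pos hkj,
        ← ENNReal.ofReal_mul (by positivity), ← ENNReal.ofReal_mul (by positivity),
        ← ENNReal.ofReal_pow (by positivity), ← ENNReal.ofReal_pow (by positivity),
        ← ENNReal.ofReal_pow (by positivity), ← ENNReal.ofReal_add (by positivity) (by positivity),
        ← ENNReal.ofReal_mul (by positivity)]
      exact ENNReal.ofReal_le_ofReal (weight_ratio_sq_le hs0 k j)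
    refine (ENNReal.tsum_le_tsum h1).trans_eq ?_
    have h2 : ∑' j, (ENNReal.ofReal (weight s (k - j)))⁻¹ ^ 2 = S :=
      (Equiv.subLeft k).tsum_eq (fun j => (ENNReal.ofReal (weight s j))⁻¹ ^ 2)
    rw [ENNReal.tsum_mul_left, ENNReal.tsum_add, h2]
  set Q := ENNReal.ofReal (4 ^ s) * (S + S) with hQ
  have hQt : Q < ⊤ := ENNReal.mul_lt_top ENNReal.ofReal_lt_top (ENNReal.add_lt_top.2 ⟨hSt, hSt⟩)
  -- `Q ≤ (Q + 1)²` replaces a square root and keeps the constant positive.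
  refine ⟨Q.toReal + 1, by positivity, fun k => (hb k).trans ?_⟩
  calc Q = ENNReal.ofReal Q.toReal := (ENNReal.ofReal_toReal hQt.ne).symm
    _ ≤ ENNReal.ofReal ((Q.toReal + 1) ^ 2) := by
        apply ENNReal.ofReal_le_ofReal
        nlinarith [ENNReal.toReal_nonneg (a := Q)]
    _ = _ := ENNReal.ofReal_pow (by positivity) 2

/-- Cauchy–Schwarz against the weights; for `s > d/2` this is the embedding of `H^s` into absolutely
convergent Fourier series. -/
lemma tsum_enorm_le (s : ℝ) (a : PerDist d) :
    ∑' k, ‖a k‖ₑ ≤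
      (∑' k : Fin d → ℤ, (ENNReal.ofReal (weight s k))⁻¹ ^ 2) ^ (1 / 2 : ℝ) * sobolevNorm s a := by
  refine ennreal_le_of_sq_le ?_
  have e : ∀ k, ‖a k‖ₑ = (ENNReal.ofReal (weight s k))⁻¹ * (ENNReal.ofReal (weight s k) * ‖a k‖ₑ) :=
    fun k => by
      rw [← mul_assoc, ENNReal.inv_mul_cancel (by simpa using weight_pos s k)
        ENNReal.ofReal_ne_top, one_mul]
  calc (∑' k, ‖a k‖ₑ) ^ 2
      = (∑' k, (ENNReal.ofReal (weight s k))⁻¹ * (ENNReal.ofReal (weight s k) * ‖a k‖ₑ)) ^ 2 := by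
        rw [tsum_congr e]
    _ ≤ _ := ennreal_tsum_mul_sq_le _ _
    _ = _ := by
        rw [mul_pow, sobolevNorm_sq, ennreal_rpow_half_sq]

end KleinGordon
end

/-! ### Fourier coefficients, products and the `H^s` product estimate -/

noncomputable section

namespace KleinGordon

variable {d : ℕ}

section Fourier

open MeasureTheory UnitAddTorus

local instance : MeasureSpace UnitAddCircle := ⟨AddCircle.haarAddCircle⟩

local instance : Measure.IsAddHaarMeasure (volume : Measure UnitAddCircle) :=
  inferInstanceAs (Measure.IsAddHaarMeasure AddCircle.haarAddCircle)

local instance : IsProbabilityMeasure (volume : Measure UnitAddCircle) :=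
  inferInstanceAs (IsProbabilityMeasure AddCircle.haarAddCircle)

/-- The `k`-th Fourier coefficient as a continuous functional on `C(𝕋^d)`. -/
def coeffCLM (k : Fin d → ℤ) : C(UnitAddTorus (Fin d), ℂ) →L[ℂ] ℂ :=
  (innerSL ℂ (mFourierLp 2 k)).comp (ContinuousMap.toLp (E := ℂ) 2 volume ℂ)

/-- Continuity for the uniform norm is what allows coefficients to be taken termwise in Fourier
series. -/
lemma coeffCLM_apply (k : Fin d → ℤ) (f : C(UnitAddTorus (Fin d), ℂ)) :
    coeffCLM k f = ofFun f k := by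
  rw [ofFun, ← mFourierCoeff_toLp, ← mFourierBasis_repr, HilbertBasis.repr_apply_apply,
    coe_mFourierBasis]
  rfl

lemma ofFun_mFourier_mul (j k : Fin d → ℤ) (f : C(UnitAddTorus (Fin d), ℂ)) :
    ofFun (mFourier j * f : C(UnitAddTorus (Fin d), ℂ)) k = ofFun f (k - j) := by
  simp only [ofFun, mFourierCoeff]
  congr 1
  ext t
  rw [show -(k - j) = -k + j by abel, mFourier_add]
  simp [mul_assoc]

lemma ofFun_mFourier (j k : Fin d → ℤ) :
    ofFun (mFourier j : C(UnitAddTorus (Fin d), ℂ)) k = if k = j then 1 else 0 := by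
  rw [← coeffCLM_apply]
  exact orthonormal_iff_ite.1 orthonormal_mFourier k j

lemma ofFun_conj (f : UnitAddTorus (Fin d) → ℂ) :
    ofFun (fun y => (starRingEnd ℂ) (f y)) = conjDist (ofFun f) := by
  ext k
  simp only [ofFun, conjDist, mFourierCoeff]
  rw [← integral_conj]
  congr 1
  ext t
  simp [mFourier_neg]

end Fourier

open UnitAddTorus

lemma summable_smul_mFourier {a : PerDist d} (ha : Summable a) :
    Summable fun k => a k • (mFourier k : C(UnitAddTorus (Fin d), ℂ)) := by
  refine Summable.of_norm ?_
  simpa only [norm_smul, mFourier_norm, mul_one] using ha.norm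

/-- The continuous function with absolutely summable Fourier coefficients `a`. -/
def toCont (a : PerDist d) : C(UnitAddTorus (Fin d), ℂ) := ∑' k, a k • mFourier k

lemma toCont_apply {a : PerDist d} (ha : Summable a) (y : UnitAddTorus (Fin d)) :
    toCont a y = toFun a y := by
  have := ((summable_smul_mFourier ha).hasSum.mapL (ContinuousMap.evalCLM ℂ y)).tsum_eq
  exact this.symm

lemma ofFun_toCont {a : PerDist d} (ha : Summable a) : ofFun (toCont a) = a := by
  ext k
  rw [← coeffCLM_apply]
  have := ((summable_smul_mFourier ha).hasSum.mapL (coeffCLM k)).tsum_eq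
  rw [toCont, ← this]
  simp only [map_smul, coeffCLM_apply, ofFun_mFourier, smul_eq_mul, mul_ite, mul_one, mul_zero]
  rw [tsum_eq_single k fun j hj => if_neg (Ne.symm hj), if_pos rfl]

lemma toCont_ofFun {f : C(UnitAddTorus (Fin d), ℂ)} (hf : Summable (ofFun f)) :
    toCont (ofFun f) = f :=
  (hasSum_mFourier_series_of_summable hf).tsum_eq

/-- Fourier coefficients turn products into convolutions. -/
lemma ofFun_toCont_mul {a b : PerDist d} (ha : Summable a) (hb : Summable b) (k : Fin d → ℤ) :
    ofFun (toCont a * toCont b : C(UnitAddTorus (Fin d), ℂ)) k = ∑' j, a j * b (k - j) := by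
  rw [← coeffCLM_apply]
  have := (((summable_smul_mFourier ha).hasSum.mul_right (toCont b)).mapL (coeffCLM k)).tsum_eq
  rw [toCont, ← this]
  refine tsum_congr fun j => ?_
  rw [smul_mul_assoc, map_smul, coeffCLM_apply, ofFun_mFourier_mul, ofFun_toCont hb, smul_eq_mul]

/-- The product estimate in `H^s`, `s > d/2`. -/
lemma exists_sobolevNorm_mul_le {s : ℝ} (hs : (d : ℝ) / 2 < s) :
    ∃ κ : ℝ, 0 < κ ∧ ∀ a b : PerDist d, Summable a → Summable b →
      sobolevNorm s (ofFun (toCont a * toCont b : C(UnitAddTorus (Fin d), ℂ)))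
        ≤ ENNReal.ofReal κ * (sobolevNorm s a * sobolevNorm s b) := by
  obtain ⟨κ, hκ0, hκ⟩ := exists_weight_const hs
  refine ⟨κ, hκ0, fun a b ha hb => ennreal_le_of_sq_le ?_⟩
  rw [mul_pow, mul_pow, sobolevNorm_sq, sobolevNorm_sq, sobolevNorm_sq]
  refine le_trans (ENNReal.tsum_le_tsum fun k => ?_)
    (tsum_weighted_convolution_sq_le (fun k => ENNReal.ofReal (weight s k)) (fun k => ‖a k‖ₑ)
    (fun k => ‖b k‖ₑ) (fun k => by simpa using weight_pos s k) (fun k => ENNReal.ofReal_ne_top) _ hκ)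
  gcongr
  rw [ofFun_toCont_mul ha hb]
  refine enorm_tsum_le_tsum_enorm.trans (ENNReal.tsum_le_tsum fun j => ?_)
  rw [enorm_mul]

lemma summable_of_sobolevNorm {s : ℝ} (hs : (d : ℝ) / 2 < s) {a : PerDist d}
    (ha : sobolevNorm s a ≠ ⊤) : Summable a := by
  have h : ∑' k, ‖a k‖ₑ ≠ ⊤ := ((tsum_enorm_le s a).trans_lt (ENNReal.mul_lt_top
    (ENNReal.rpow_lt_top_of_nonneg (by norm_num) (tsum_ofReal_weight_inv_sq_lt_top hs).ne)
    ha.lt_top)).ne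
  exact Summable.of_norm (tsum_enorm_ne_top_iff_summable_norm.1 h)

end KleinGordon
end

/-! ### The Sobolev space as a commutative Banach algebra -/

noncomputable section

namespace KleinGordon

variable {d : ℕ} {s : ℝ}

open UnitAddTorus

/-- A constant in the product estimate of `H^s` (for `s > d/2`), used to normalize the norm. -/
def algConst (d : ℕ) (s : ℝ) : ℝ :=
  open Classical in if hs : (d : ℝ) / 2 < s then (exists_sobolevNorm_mul_le hs).choose else 1

lemma algConst_pos (d : ℕ) (s : ℝ) : 0 < algConst d s := by
  unfold algConst
  split_ifs with hs
  · exact (exists_sobolevNorm_mul_le hs).choose_spec.1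
  · exact one_pos

lemma sobolevNorm_mul_le (hs : (d : ℝ) / 2 < s) {a b : PerDist d} (ha : Summable a)
    (hb : Summable b) :
    sobolevNorm s (ofFun (toCont a * toCont b : C(UnitAddTorus (Fin d), ℂ)))
      ≤ ENNReal.ofReal (algConst d s) * (sobolevNorm s a * sobolevNorm s b) := by
  unfold algConst
  rw [dif_pos hs]
  exact (exists_sobolevNorm_mul_le hs).choose_spec.2 a b ha hb

/-- The Sobolev space `H^s` on the torus, modelled on `ℓ²`. Its norm is the Sobolev norm times
`algConst d s`. -/
def Sob (d : ℕ) (_ : ℝ) : Type := lp (fun _ : Fin d → ℤ => ℂ) 2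

namespace Sob

instance : NormedAddCommGroup (Sob d s) :=
  inferInstanceAs (NormedAddCommGroup (lp (fun _ : Fin d → ℤ => ℂ) 2))

instance : NormedSpace ℂ (Sob d s) :=
  inferInstanceAs (NormedSpace ℂ (lp (fun _ : Fin d → ℤ => ℂ) 2))

instance : CompleteSpace (Sob d s) :=
  inferInstanceAs (CompleteSpace (lp (fun _ : Fin d → ℤ => ℂ) 2))

/-- The underlying square summable sequence. -/
def toLp (x : Sob d s) : lp (fun _ : Fin d → ℤ => ℂ) 2 := x

/-- The factor between the Fourier coefficients and the underlying square summable sequence. -/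
def scale (s : ℝ) (k : Fin d → ℤ) : ℝ := algConst d s * weight s k

lemma scale_pos (k : Fin d → ℤ) : 0 < scale s k := mul_pos (algConst_pos d s) (weight_pos s k)

/-- The Fourier coefficients of an element of `H^s`. -/
def coeff : Sob d s →ₗ[ℂ] PerDist d where
  toFun x := fun k => ((scale s k)⁻¹ : ℝ) * toLp x k
  map_add' x y := by ext k; exact mul_add _ _ _
  map_smul' c x := by ext k; exact mul_left_comm _ _ _

lemma coeff_apply (x : Sob d s) (k : Fin d → ℤ) : coeff x k = ((scale s k)⁻¹ : ℝ) * toLp x k := rfl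

lemma coeff_injective : Function.Injective (coeff (d := d) (s := s)) := by
  intro x y h
  refine lp.ext (funext fun k => ?_)
  have := congrFun h k
  rw [coeff_apply, coeff_apply] at this
  exact mul_left_cancel₀ (by exact_mod_cast (inv_pos.2 (scale_pos k)).ne') this

lemma enorm_sq (x : Sob d s) : ‖x‖ₑ ^ 2 = ∑' k, ‖toLp x k‖ₑ ^ 2 := by
  have h := lp.hasSum_norm (p := 2) (by norm_num) (toLp x)
  have h2 : ∀ t : ℝ, t ^ (2 : ℝ≥0∞).toReal = t ^ 2 := fun t => by norm_num
  simp only [h2] at h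
  have h3 := ENNReal.ofReal_tsum_of_nonneg (fun k => sq_nonneg ‖toLp x k‖) h.summable
  rw [h.tsum_eq, ENNReal.ofReal_pow (norm_nonneg _), ofReal_norm] at h3
  simp only [ENNReal.ofReal_pow (norm_nonneg _), ofReal_norm] at h3
  exact h3

lemma enorm_eq (x : Sob d s) :
    ‖x‖ₑ = ENNReal.ofReal (algConst d s) * sobolevNorm s (coeff x) := by
  refine (ENNReal.pow_right_strictMono two_ne_zero).injective ?_
  rw [mul_pow, sobolevNorm_sq, enorm_sq, ← ENNReal.tsum_mul_left]
  refine tsum_congr fun k => ?_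
  rw [← mul_pow, coeff_apply, enorm_mul, ← mul_assoc, ← mul_assoc,
    ← ENNReal.ofReal_mul (algConst_pos d s).le]
  have : ‖(((scale s k)⁻¹ : ℝ) : ℂ)‖ₑ = ENNReal.ofReal (scale s k)⁻¹ := by
    rw [← ofReal_norm, Complex.norm_real, Real.norm_of_nonneg (inv_pos.2 (scale_pos k)).le]
  rw [this, ← scale, ← ENNReal.ofReal_mul (scale_pos (s := s) k).le,
    mul_inv_cancel₀ (scale_pos k).ne', ENNReal.ofReal_one, one_mul]

lemma sobolevNorm_coeff (x : Sob d s) :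
    sobolevNorm s (coeff x) = ENNReal.ofReal (‖x‖ / algConst d s) := by
  have h := algConst_pos d s
  rw [ENNReal.ofReal_div_of_pos h, ofReal_norm, enorm_eq, mul_comm, ENNReal.mul_div_cancel_right]
  · simpa using h
  · exact ENNReal.ofReal_ne_top

lemma sobolevNorm_coeff_ne_top (x : Sob d s) : sobolevNorm s (coeff x) ≠ ⊤ := by
  rw [sobolevNorm_coeff]; exact ENNReal.ofReal_ne_top

lemma exists_coeff_eq {a : PerDist d} (ha : sobolevNorm s a ≠ ⊤) :
    ∃ x : Sob d s, coeff x = a := by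
  have h : ∑' k, ‖(scale s k : ℂ) * a k‖ₑ ^ 2 ≠ ⊤ := by
    have e : ∀ k, ‖(scale s k : ℂ) * a k‖ₑ ^ 2 = ENNReal.ofReal (algConst d s) ^ 2 *
        (ENNReal.ofReal (weight s k) * ‖a k‖ₑ) ^ 2 := by
      intro k
      rw [enorm_mul, ← mul_pow, ← mul_assoc, ← ENNReal.ofReal_mul (algConst_pos d s).le,
        ← ofReal_norm (scale s k : ℂ), Complex.norm_real, Real.norm_of_nonneg (scale_pos k).le,
        scale]
    rw [tsum_congr e, ENNReal.tsum_mul_left, ← sobolevNorm_sq]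
    exact ENNReal.mul_ne_top (by simp) (ENNReal.pow_ne_top ha)
  have hm : Memℓp (fun k => (scale s k : ℂ) * a k) 2 := by
    refine memℓp_gen ?_
    have := ENNReal.summable_toReal h
    simpa [ENNReal.toReal_pow] using this
  refine ⟨(⟨_, hm⟩ : lp (fun _ : Fin d → ℤ => ℂ) 2), funext fun k => ?_⟩
  have : (scale s k : ℂ) ≠ 0 := by exact_mod_cast (scale_pos k).ne'
  change ((scale s k)⁻¹ : ℝ) * ((scale s k : ℂ) * a k) = a k
  push_cast
  field_simp

/-- The element of `H^s` with given Fourier coefficients. -/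
def ofDist (a : PerDist d) (ha : sobolevNorm s a ≠ ⊤) : Sob d s := (exists_coeff_eq ha).choose

@[simp] lemma coeff_ofDist (a : PerDist d) (ha : sobolevNorm s a ≠ ⊤) :
    coeff (ofDist a ha) = a := (exists_coeff_eq ha).choose_spec

lemma norm_le_of_sobolevNorm_le {x : Sob d s} {b : ℝ} (hb : 0 ≤ b)
    (h : sobolevNorm s (coeff x) ≤ ENNReal.ofReal b) : ‖x‖ ≤ algConst d s * b := by
  rw [sobolevNorm_coeff, ENNReal.ofReal_le_ofReal_iff hb, div_le_iff₀ (algConst_pos d s)] at h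
  linarith

lemma norm_le_norm {x y : Sob d s}
    (h : sobolevNorm s (coeff x) ≤ sobolevNorm s (coeff y)) : ‖x‖ ≤ ‖y‖ := by
  have := algConst_pos d s
  rwa [sobolevNorm_coeff, sobolevNorm_coeff, ENNReal.ofReal_le_ofReal_iff (by positivity),
    div_le_div_iff_of_pos_right this] at h

lemma sobolevNorm_ofFun_one_ne_top :
    sobolevNorm s (ofFun (1 : C(UnitAddTorus (Fin d), ℂ))) ≠ ⊤ := by
  rw [sobolevNorm_eq]
  refine (ENNReal.rpow_lt_top_of_nonneg (by norm_num) ?_).ne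
  rw [← mFourier_zero, tsum_eq_single 0]
  · rw [ofFun_mFourier]; exact ENNReal.pow_ne_top (ENNReal.mul_ne_top (by simp) (by simp))
  · intro k hk
    rw [ofFun_mFourier, if_neg hk]; simp

section Algebra

variable [hs : Fact ((d : ℝ) / 2 < s)]

lemma summable_coeff (x : Sob d s) : Summable (coeff x) :=
  summable_of_sobolevNorm hs.out (sobolevNorm_coeff_ne_top x)

/-- The continuous function on the torus represented by an element of `H^s`, `s > d/2`. -/
def toC : Sob d s →ₗ[ℂ] C(UnitAddTorus (Fin d), ℂ) where
  toFun x := toCont (coeff x)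
  map_add' x y := by
    rw [map_add]
    exact (tsum_congr fun k => add_smul (coeff x k) (coeff y k) _).trans
      ((summable_smul_mFourier (summable_coeff x)).tsum_add
        (summable_smul_mFourier (summable_coeff y)))
  map_smul' c x := by
    simp only [toCont, map_smul, Pi.smul_apply, smul_assoc, RingHom.id_apply]
    exact (summable_smul_mFourier (summable_coeff x)).tsum_const_smul c

lemma toC_apply (x : Sob d s) (y : UnitAddTorus (Fin d)) : toC x y = toFun (coeff x) y :=
  toCont_apply (summable_coeff x) y

lemma ofFun_toC (x : Sob d s) : ofFun (toC x) = coeff x := ofFun_toCont (summable_coeff x)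

lemma toC_injective : Function.Injective (toC (d := d) (s := s)) := by
  intro x y h
  apply coeff_injective
  rw [← ofFun_toC, ← ofFun_toC, h]

lemma toC_ofDist (f : C(UnitAddTorus (Fin d), ℂ)) (hf : sobolevNorm s (ofFun f) ≠ ⊤) :
    toC (ofDist (ofFun f) hf) = f := by
  change toCont (coeff _) = f
  rw [coeff_ofDist]
  exact toCont_ofFun (summable_of_sobolevNorm hs.out hf)

lemma continuous_toC : Continuous (toC (d := d) (s := s)) := by
  set D := (∑' k : Fin d → ℤ, (ENNReal.ofReal (weight s k))⁻¹ ^ 2) ^ (1 / 2 : ℝ) with hD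
  have hDt : D ≠ ⊤ := (ENNReal.rpow_lt_top_of_nonneg (by norm_num)
    (tsum_ofReal_weight_inv_sq_lt_top hs.out).ne).ne
  refine AddMonoidHomClass.continuous_of_bound toC (D.toReal / algConst d s) fun x => ?_
  have h : ‖toC x‖ₑ ≤ D * ENNReal.ofReal (‖x‖ / algConst d s) := by
    rw [← sobolevNorm_coeff]
    refine le_trans ?_ (tsum_enorm_le s (coeff x))
    refine (enorm_tsum_le_tsum_enorm (ε := C(UnitAddTorus (Fin d), ℂ))).trans
      (ENNReal.tsum_le_tsum fun k => ?_)
    rw [enorm_smul, ← ofReal_norm (mFourier k : C(UnitAddTorus (Fin d), ℂ)), mFourier_norm]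
    simp
  have h0 : 0 ≤ ‖x‖ / algConst d s := div_nonneg (norm_nonneg _) (algConst_pos d s).le
  rw [← ENNReal.ofReal_toReal hDt, ← ENNReal.ofReal_mul ENNReal.toReal_nonneg, ← ofReal_norm,
    ENNReal.ofReal_le_ofReal_iff (by positivity)] at h
  calc _ ≤ _ := h
    _ = _ := by ring

lemma sobolevNorm_toC_mul (x y : Sob d s) :
    sobolevNorm s (ofFun (toC x * toC y : C(UnitAddTorus (Fin d), ℂ)))
      ≤ ENNReal.ofReal (algConst d s) * (sobolevNorm s (coeff x) * sobolevNorm s (coeff y)) :=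
  sobolevNorm_mul_le hs.out (summable_coeff x) (summable_coeff y)

instance : Mul (Sob d s) where
  mul x y := ofDist (ofFun (toC x * toC y : C(UnitAddTorus (Fin d), ℂ)))
    ((sobolevNorm_toC_mul x y).trans_lt (ENNReal.mul_lt_top ENNReal.ofReal_lt_top
      (ENNReal.mul_lt_top (sobolevNorm_coeff_ne_top x).lt_top
        (sobolevNorm_coeff_ne_top y).lt_top))).ne

instance : One (Sob d s) where
  one := ofDist (ofFun (1 : C(UnitAddTorus (Fin d), ℂ))) sobolevNorm_ofFun_one_ne_top

lemma toC_mul (x y : Sob d s) : toC (x * y) = toC x * toC y := toC_ofDist _ _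

lemma toC_one : toC (1 : Sob d s) = 1 := toC_ofDist _ _

/-- The ring laws are those of pointwise multiplication, pulled back along the injection `toC`. -/
instance : CommRing (Sob d s) where
  left_distrib x y z := toC_injective (by simp only [toC_mul, map_add, mul_add])
  right_distrib x y z := toC_injective (by simp only [toC_mul, map_add, add_mul])
  zero_mul x := toC_injective (by simp only [toC_mul, map_zero, zero_mul])
  mul_zero x := toC_injective (by simp only [toC_mul, map_zero, mul_zero])
  mul_assoc x y z := toC_injective (by simp only [toC_mul, mul_assoc])
  one_mul x := toC_injective (by simp only [toC_mul, toC_one, one_mul])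
  mul_one x := toC_injective (by simp only [toC_mul, toC_one, mul_one])
  mul_comm x y := toC_injective (by simp only [toC_mul, mul_comm])
  zsmul := fun n x => n • x
  zsmul_zero' := SubNegMonoid.zsmul_zero'
  zsmul_succ' := SubNegMonoid.zsmul_succ'
  zsmul_neg' := SubNegMonoid.zsmul_neg'
  neg_add_cancel := neg_add_cancel

/-- The factor `algConst d s` in the norm cancels the constant of the product estimate. -/
instance : NormedCommRing (Sob d s) where
  dist_eq := NormedAddGroup.dist_eq
  mul_comm := mul_comm
  norm_mul_le x y := by
    have h := sobolevNorm_toC_mul x y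
    have e : ofFun (toC x * toC y : C(UnitAddTorus (Fin d), ℂ)) = coeff (x * y) :=
      (coeff_ofDist _ _).symm
    have hp := algConst_pos d s
    rw [e, sobolevNorm_coeff x, sobolevNorm_coeff y, ← ENNReal.ofReal_mul (by positivity),
      ← ENNReal.ofReal_mul hp.le] at h
    refine (norm_le_of_sobolevNorm_le (by positivity) h).trans_eq ?_
    field_simp

instance : NormedAlgebra ℂ (Sob d s) where
  toAlgebra := Algebra.ofModule
    (fun c x y => toC_injective (by simp only [toC_mul, map_smul, smul_mul_assoc]))
    (fun c x y => toC_injective (by simp only [toC_mul, map_smul, mul_smul_comm]))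
  norm_smul_le c x := norm_smul_le c x

end Algebra

end Sob

end KleinGordon
end

/-! ### Bounds for the nonlinear increments in a Banach algebra -/

noncomputable section

namespace KleinGordon

variable {d : ℕ} {s : ℝ}

section Exponential

variable {𝔸 : Type*} [NormedCommRing 𝔸] [NormedAlgebra ℂ 𝔸]

/-- The norm of `1` is not assumed to be `1`. Removing the constant term leaves only positive
powers, for which submultiplicativity suffices. -/
lemma norm_exp_sub_one_le_mul_exp [CompleteSpace 𝔸] (x : 𝔸) :
    ‖NormedSpace.exp x - 1‖ ≤ ‖x‖ * Real.exp ‖x‖ := by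
  have h := NormedSpace.exp_series_hasSum_exp' (𝕂 := ℂ) x
  have h1 : HasSum (fun n : ℕ => (((n + 1).factorial : ℂ)⁻¹) • x ^ (n + 1))
      (NormedSpace.exp x - 1) := by
    have := (hasSum_nat_add_iff' 1).2 h
    simpa using this
  have h2 : HasSum (fun n : ℕ => ‖x‖ * (‖x‖ ^ n / n.factorial)) (‖x‖ * Real.exp ‖x‖) := by
    have := NormedSpace.expSeries_div_hasSum_exp (𝔸 := ℝ) ‖x‖
    rw [← Real.exp_eq_exp_ℝ] at this
    exact this.mul_left _
  refine h1.norm_le_of_bounded h2 fun n => ?_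
  rw [norm_smul, norm_inv, Complex.norm_natCast]
  have h3 : ‖x ^ (n + 1)‖ ≤ ‖x‖ ^ (n + 1) := norm_pow_le' x n.succ_pos
  have h4 : ((n.factorial : ℝ)) ≤ ((n + 1).factorial : ℝ) := by
    exact_mod_cast Nat.factorial_le n.le_succ
  have h5 : (0 : ℝ) < n.factorial := by exact_mod_cast n.factorial_pos
  calc ((n + 1).factorial : ℝ)⁻¹ * ‖x ^ (n + 1)‖
      ≤ (n.factorial : ℝ)⁻¹ * ‖x‖ ^ (n + 1) := by gcongr
    _ = _ := by rw [pow_succ]; ring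

lemma norm_exp_sub_exp_le [CompleteSpace 𝔸] {x y : 𝔸} {ρ : ℝ} (hx : ‖x‖ ≤ ρ) (hy : ‖y‖ ≤ ρ) :
    ‖NormedSpace.exp x - NormedSpace.exp y‖
      ≤ ‖x - y‖ * (Real.exp (2 * ρ) * (1 + ρ * Real.exp ρ)) := by
  let _ : NormedAlgebra ℚ 𝔸 := NormedAlgebra.restrictScalars ℚ ℂ 𝔸
  have hρ : 0 ≤ ρ := (norm_nonneg x).trans hx
  -- Writing `e^y = 1 + (e^y - 1)` in the factorization `(e^{x-y} - 1) e^y` keeps `‖1‖` out of the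
  -- bound.
  have e : NormedSpace.exp x - NormedSpace.exp y
      = (NormedSpace.exp (x - y) - 1) + (NormedSpace.exp (x - y) - 1) * (NormedSpace.exp y - 1) := by
    have : NormedSpace.exp x = NormedSpace.exp (x - y) * NormedSpace.exp y := by
      rw [← NormedSpace.exp_add, sub_add_cancel]
    rw [this]; ring
  have hxy : ‖x - y‖ ≤ 2 * ρ := (norm_sub_le x y).trans (by linarith)
  have h1 : ‖NormedSpace.exp (x - y) - 1‖ ≤ ‖x - y‖ * Real.exp (2 * ρ) :=
    (norm_exp_sub_one_le_mul_exp _).trans (by gcongr)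
  have h2 : ‖NormedSpace.exp y - 1‖ ≤ ρ * Real.exp ρ :=
    (norm_exp_sub_one_le_mul_exp _).trans (by gcongr)
  calc _ ≤ ‖NormedSpace.exp (x - y) - 1‖
        + ‖NormedSpace.exp (x - y) - 1‖ * ‖NormedSpace.exp y - 1‖ := by
        rw [e]; exact (norm_add_le _ _).trans (by gcongr; exact norm_mul_le _ _)
    _ ≤ ‖x - y‖ * Real.exp (2 * ρ) + (‖x - y‖ * Real.exp (2 * ρ)) * (ρ * Real.exp ρ) := by gcongr
    _ = _ := by ring

lemma norm_phase_smul_le {τ : ℝ} {p : 𝔸} {b : ℝ} (hτ : 0 ≤ τ) (hp : ‖p‖ ≤ 8 * b) :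
    ‖(-(τ : ℂ) * (Complex.I / 8)) • p‖ ≤ τ * b := by
  rw [norm_smul]
  have : ‖-(τ : ℂ) * (Complex.I / 8)‖ = τ / 8 := by
    rw [norm_mul, norm_neg, Complex.norm_real, Real.norm_of_nonneg hτ, norm_div, Complex.norm_I]
    norm_num; ring
  rw [this]
  calc τ / 8 * ‖p‖ ≤ τ / 8 * (8 * b) := by gcongr
    _ = _ := by ring

variable [StarAddMonoid 𝔸] [NormedStarGroup 𝔸]

/-- The potential `|u|² + 2|v|²` in a Banach algebra with isometric conjugation. -/
def pot (u v : 𝔸) : 𝔸 := u * star u + (2 : ℂ) • (v * star v)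

/-- The increment `e^{-iτ(|u|² + 2|v|²)/8} u - u`. -/
def phaseIncr (τ : ℝ) (u v : 𝔸) : 𝔸 :=
  (NormedSpace.exp ((-(τ : ℂ) * (Complex.I / 8)) • pot u v) - 1) * u

/-- The oscillatory cubic nonlinearity with coefficients `α`, `β`, `γ`. -/
def osc (α β γ : ℂ) (u v : 𝔸) : 𝔸 :=
  α • (u * u * v) + β • (((2 : ℂ) • (u * star u) + v * star v) * star v)
    + γ • (star v * star v * star u)

lemma norm_pot_le {u v : 𝔸} {R : ℝ} (hu : ‖u‖ ≤ R) (hv : ‖v‖ ≤ R) : ‖pot u v‖ ≤ 3 * R ^ 2 := by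
  have hR : 0 ≤ R := (norm_nonneg u).trans hu
  have h : ∀ w : 𝔸, ‖w‖ ≤ R → ‖w * star w‖ ≤ R * R := fun w hw =>
    (norm_mul_le _ _).trans (by rw [norm_star]; gcongr)
  calc ‖pot u v‖ ≤ ‖u * star u‖ + ‖(2 : ℂ) • (v * star v)‖ := norm_add_le _ _
    _ ≤ R * R + 2 * (R * R) := by
        rw [norm_smul]
        have := h u hu
        have := h v hv
        norm_num
        gcongr
    _ = _ := by ring

lemma norm_pot_sub_le {u v u' v' : 𝔸} {R : ℝ} (hu : ‖u‖ ≤ R) (hv : ‖v‖ ≤ R) (hu' : ‖u'‖ ≤ R)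
    (hv' : ‖v'‖ ≤ R) : ‖pot u v - pot u' v'‖ ≤ 4 * R * (‖u - u'‖ + ‖v - v'‖) := by
  have hR : 0 ≤ R := (norm_nonneg u).trans hu
  have h : ∀ w w' : 𝔸, ‖w‖ ≤ R → ‖w'‖ ≤ R →
      ‖w * star w - w' * star w'‖ ≤ 2 * R * ‖w - w'‖ := by
    intro w w' hw hw'
    have e : w * star w - w' * star w' = (w - w') * star w + w' * star (w - w') := by
      rw [star_sub]; ring
    rw [e]
    calc _ ≤ ‖w - w'‖ * ‖star w‖ + ‖w'‖ * ‖star (w - w')‖ :=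
          (norm_add_le _ _).trans (add_le_add (norm_mul_le _ _) (norm_mul_le _ _))
      _ ≤ ‖w - w'‖ * R + R * ‖w - w'‖ := by rw [norm_star, norm_star]; gcongr
      _ = _ := by ring
  have e : pot u v - pot u' v' = (u * star u - u' * star u')
      + (2 : ℂ) • (v * star v - v' * star v') := by
    simp only [pot, smul_sub]; abel
  rw [e]
  refine (norm_add_le _ _).trans ?_
  rw [norm_smul]
  have h1 := h u u' hu hu'
  have h2 := h v v' hv hv'
  have h3 : 0 ≤ R * ‖u - u'‖ := by positivity
  norm_num
  linarith

lemma norm_phaseIncr_le [CompleteSpace 𝔸] {u v : 𝔸} {τ R : ℝ} (hτ : 0 ≤ τ) (hτ1 : τ ≤ 1) (hu : ‖u‖ ≤ R)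
    (hv : ‖v‖ ≤ R) : ‖phaseIncr τ u v‖ ≤ τ * (R ^ 3 * Real.exp (R ^ 2)) := by
  have hR : 0 ≤ R := (norm_nonneg u).trans hu
  have h1 : ‖(-(τ : ℂ) * (Complex.I / 8)) • pot u v‖ ≤ τ * R ^ 2 :=
    norm_phase_smul_le hτ ((norm_pot_le hu hv).trans (by nlinarith [sq_nonneg R]))
  have h2 : τ * R ^ 2 ≤ R ^ 2 := mul_le_of_le_one_left (sq_nonneg R) hτ1
  calc ‖phaseIncr τ u v‖ ≤ ‖(-(τ : ℂ) * (Complex.I / 8)) • pot u v‖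
        * Real.exp ‖(-(τ : ℂ) * (Complex.I / 8)) • pot u v‖ * ‖u‖ :=
        (norm_mul_le _ _).trans (by gcongr; exact norm_exp_sub_one_le_mul_exp _)
    _ ≤ (τ * R ^ 2) * Real.exp (R ^ 2) * R := by gcongr; exact h1.trans h2
    _ = _ := by ring

/-- The Lipschitz constant of `τ⁻¹ • phaseIncr τ` on the ball of radius `R`. -/
def phaseLip (R : ℝ) : ℝ :=
  R ^ 2 * (Real.exp (2 * R ^ 2) * (1 + R ^ 2 * Real.exp (R ^ 2))) + R ^ 2 * Real.exp (R ^ 2)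

lemma norm_phaseIncr_sub_le [CompleteSpace 𝔸] {u v u' v' : 𝔸} {τ R : ℝ} (hτ : 0 ≤ τ) (hτ1 : τ ≤ 1) (hu : ‖u‖ ≤ R)
    (hv : ‖v‖ ≤ R) (hu' : ‖u'‖ ≤ R) (hv' : ‖v'‖ ≤ R) :
    ‖phaseIncr τ u v - phaseIncr τ u' v'‖ ≤ τ * (phaseLip R * (‖u - u'‖ + ‖v - v'‖)) := by
  have hR : 0 ≤ R := (norm_nonneg u).trans hu
  set Δ := ‖u - u'‖ + ‖v - v'‖ with hΔ
  have hΔ0 : 0 ≤ Δ := by positivity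
  set Y := (-(τ : ℂ) * (Complex.I / 8)) • pot u v with hY
  set Y' := (-(τ : ℂ) * (Complex.I / 8)) • pot u' v' with hY'
  have h2 : τ * R ^ 2 ≤ R ^ 2 := mul_le_of_le_one_left (sq_nonneg R) hτ1
  have h1 : ‖Y‖ ≤ τ * R ^ 2 :=
    norm_phase_smul_le hτ ((norm_pot_le hu hv).trans (by nlinarith [sq_nonneg R]))
  have h1' : ‖Y'‖ ≤ τ * R ^ 2 :=
    norm_phase_smul_le hτ ((norm_pot_le hu' hv').trans (by nlinarith [sq_nonneg R]))
  have h3 : ‖Y - Y'‖ ≤ τ * (R * Δ) := by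
    rw [hY, hY', ← smul_sub]
    exact norm_phase_smul_le hτ ((norm_pot_sub_le hu hv hu' hv').trans
      (by nlinarith [mul_nonneg hR hΔ0]))
  have h4 := norm_exp_sub_exp_le (h1.trans h2) (h1'.trans h2)
  have h5 : ‖NormedSpace.exp Y' - 1‖ ≤ τ * R ^ 2 * Real.exp (R ^ 2) :=
    (norm_exp_sub_one_le_mul_exp _).trans (by gcongr; exact h1'.trans h2)
  have e : phaseIncr τ u v - phaseIncr τ u' v'
      = (NormedSpace.exp Y - NormedSpace.exp Y') * u + (NormedSpace.exp Y' - 1) * (u - u') := by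
    simp only [phaseIncr, ← hY, ← hY']; ring
  have h6 : ‖u - u'‖ ≤ Δ := by rw [hΔ]; linarith [norm_nonneg (v - v')]
  calc _ ≤ ‖NormedSpace.exp Y - NormedSpace.exp Y'‖ * ‖u‖
        + ‖NormedSpace.exp Y' - 1‖ * ‖u - u'‖ := by
        rw [e]; exact (norm_add_le _ _).trans (add_le_add (norm_mul_le _ _) (norm_mul_le _ _))
    _ ≤ (τ * (R * Δ)) * (Real.exp (2 * R ^ 2) * (1 + R ^ 2 * Real.exp (R ^ 2))) * R
        + (τ * R ^ 2 * Real.exp (R ^ 2)) * Δ := by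
        gcongr
        exact h4.trans (by gcongr)
    _ = _ := by rw [phaseLip]; ring

lemma norm_cubic_le {u v : 𝔸} {R : ℝ} (hu : ‖u‖ ≤ R) (hv : ‖v‖ ≤ R) :
    ‖pot u v * u‖ ≤ 3 * R ^ 3 := by
  have hR : 0 ≤ R := (norm_nonneg u).trans hu
  calc _ ≤ ‖pot u v‖ * ‖u‖ := norm_mul_le _ _
    _ ≤ (3 * R ^ 2) * R := by gcongr; exact norm_pot_le hu hv
    _ = _ := by ring

lemma norm_osc_le {u v : 𝔸} {α β γ : ℂ} {R p : ℝ} (hu : ‖u‖ ≤ R) (hv : ‖v‖ ≤ R) (hα : ‖α‖ ≤ p)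
    (hβ : ‖β‖ ≤ p) (hγ : ‖γ‖ ≤ p) : ‖osc α β γ u v‖ ≤ 5 * R ^ 3 * p := by
  have hR : 0 ≤ R := (norm_nonneg u).trans hu
  have hp : 0 ≤ p := (norm_nonneg α).trans hα
  have h3 : ∀ a b c : 𝔸, ‖a‖ ≤ R → ‖b‖ ≤ R → ‖c‖ ≤ R → ‖a * b * c‖ ≤ R * R * R := by
    intro a b c ha hb hc
    refine (norm_mul_le _ _).trans ?_
    gcongr
    exact (norm_mul_le _ _).trans (by gcongr)
  have su : ‖star u‖ ≤ R := by rwa [norm_star]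
  have sv : ‖star v‖ ≤ R := by rwa [norm_star]
  have hm : ‖((2 : ℂ) • (u * star u) + v * star v) * star v‖ ≤ 3 * (R * R * R) := by
    rw [add_mul, smul_mul_assoc]
    refine (norm_add_le _ _).trans ?_
    rw [norm_smul]
    have := h3 u (star u) (star v) hu su sv
    have := h3 v (star v) (star v) hv sv sv
    norm_num
    linarith
  calc ‖osc α β γ u v‖ ≤ ‖α‖ * ‖u * u * v‖
        + ‖β‖ * ‖((2 : ℂ) • (u * star u) + v * star v) * star v‖
        + ‖γ‖ * ‖star v * star v * star u‖ := by
        refine (norm_add₃_le).trans_eq ?_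
        rw [norm_smul, norm_smul, norm_smul]
    _ ≤ p * (R * R * R) + p * (3 * (R * R * R)) + p * (R * R * R) := by
        gcongr
        · exact h3 _ _ _ hu hu hv
        · exact h3 _ _ _ sv sv su
    _ = _ := by ring

end Exponential

end KleinGordon
end

/-! ### Conjugation, Fourier multipliers and pointwise meaning of the algebra operations -/

noncomputable section

namespace KleinGordon

variable {d : ℕ} {s : ℝ}

open UnitAddTorus

lemma conjDist_conjDist (a : PerDist d) : conjDist (conjDist a) = a := by
  ext k; simp [conjDist]

lemma conjDist_add (a b : PerDist d) : conjDist (a + b) = conjDist a + conjDist b := by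
  ext k; simp [conjDist]

lemma sobolevNorm_conjDist (s : ℝ) (a : PerDist d) :
    sobolevNorm s (conjDist a) = sobolevNorm s a := by
  rw [sobolevNorm_eq, sobolevNorm_eq]
  congr 1
  rw [← (Equiv.neg (Fin d → ℤ)).tsum_eq]
  refine tsum_congr fun k => ?_
  rw [Equiv.neg_apply, weight_neg, conjDist, neg_neg, ← ofReal_norm, RCLike.norm_conj, ofReal_norm]

/-- A symbol bound between weights gives a bound for the Fourier multiplier. -/
lemma sobolevNorm_multiplier_le {r ρ b : ℝ} {m : (Fin d → ℤ) → ℂ} (hb : 0 ≤ b)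
    (hm : ∀ k, weight r k * ‖m k‖ ≤ b * weight ρ k) (a : PerDist d) :
    sobolevNorm r (multiplier m a) ≤ ENNReal.ofReal b * sobolevNorm ρ a := by
  refine ennreal_le_of_sq_le ?_
  rw [mul_pow, sobolevNorm_sq, sobolevNorm_sq, ← ENNReal.tsum_mul_left]
  refine ENNReal.tsum_le_tsum fun k => ?_
  rw [← mul_pow, multiplier, enorm_mul, ← mul_assoc, ← mul_assoc]
  refine pow_le_pow_left₀ (by positivity) (mul_le_mul_left ?_ _) 2
  rw [← ofReal_norm (m k), ← ENNReal.ofReal_mul (weight_pos r k).le, ← ENNReal.ofReal_mul hb]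
  exact ENNReal.ofReal_le_ofReal (hm k)

lemma sobolevNorm_multiplier_le_self {m : (Fin d → ℤ) → ℂ} (hm : ∀ k, ‖m k‖ ≤ 1)
    (s : ℝ) (a : PerDist d) : sobolevNorm s (multiplier m a) ≤ sobolevNorm s a := by
  simpa using sobolevNorm_multiplier_le (r := s) (ρ := s) zero_le_one
    (fun k => by nlinarith [hm k, weight_pos s k]) a

namespace Sob

instance : Star (Sob d s) where
  star x := ofDist (conjDist (coeff x)) (by
    rw [sobolevNorm_conjDist]; exact sobolevNorm_coeff_ne_top x)

@[simp] lemma coeff_star (x : Sob d s) : coeff (star x) = conjDist (coeff x) := coeff_ofDist _ _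

instance : StarAddMonoid (Sob d s) where
  star_involutive x := coeff_injective (by rw [coeff_star, coeff_star, conjDist_conjDist])
  star_add x y := coeff_injective (by
    rw [map_add, coeff_star, coeff_star, coeff_star, map_add, conjDist_add])

instance : NormedStarGroup (Sob d s) where
  norm_star_le x := norm_le_norm (by rw [coeff_star, sobolevNorm_conjDist])

lemma sobolevNorm_multiplier_coeff_ne_top {m : (Fin d → ℤ) → ℂ} (hm : ∀ k, ‖m k‖ ≤ 1)
    (x : Sob d s) : sobolevNorm s (multiplier m (coeff x)) ≠ ⊤ :=
  ((sobolevNorm_multiplier_le_self hm s _).trans_lt (sobolevNorm_coeff_ne_top x).lt_top).ne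

/-- The Fourier multiplier with a symbol bounded by `1`, acting on `H^s`. -/
def mulOp (m : (Fin d → ℤ) → ℂ) (hm : ∀ k, ‖m k‖ ≤ 1) : Sob d s →ₗ[ℂ] Sob d s where
  toFun x := ofDist (multiplier m (coeff x)) (sobolevNorm_multiplier_coeff_ne_top hm x)
  map_add' x y := coeff_injective (by
    rw [map_add coeff (ofDist _ _), coeff_ofDist, coeff_ofDist, coeff_ofDist, map_add]
    ext k; exact mul_add _ _ _)
  map_smul' c x := coeff_injective (by
    rw [map_smul coeff _ (ofDist _ _), coeff_ofDist, coeff_ofDist, map_smul]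
    ext k; exact mul_left_comm _ _ _)

@[simp] lemma coeff_mulOp (m : (Fin d → ℤ) → ℂ) (hm : ∀ k, ‖m k‖ ≤ 1) (x : Sob d s) :
    coeff (mulOp m hm x) = multiplier m (coeff x) :=
  coeff_ofDist _ (sobolevNorm_multiplier_coeff_ne_top hm x)

lemma norm_mulOp_le (m : (Fin d → ℤ) → ℂ) (hm : ∀ k, ‖m k‖ ≤ 1) (x : Sob d s) :
    ‖mulOp m hm x‖ ≤ ‖x‖ :=
  norm_le_norm (by rw [coeff_mulOp]; exact sobolevNorm_multiplier_le_self hm s _)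

lemma norm_le_of_coeff_eq_multiplier {r ρ b : ℝ} {m : (Fin d → ℤ) → ℂ} (hb : 0 ≤ b)
    (hm : ∀ k, weight r k * ‖m k‖ ≤ b * weight ρ k) {x : Sob d r} {y : Sob d ρ}
    (h : coeff x = multiplier m (coeff y)) :
    ‖x‖ ≤ b * (algConst d r / algConst d ρ * ‖y‖) := by
  have h1 := sobolevNorm_multiplier_le hb hm (coeff y)
  have hr := algConst_pos d r
  have hρ := algConst_pos d ρ
  rw [← h, sobolevNorm_coeff y, ← ENNReal.ofReal_mul hb] at h1
  refine (norm_le_of_sobolevNorm_le (by positivity) h1).trans_eq ?_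
  ring

section Algebra

variable [hs : Fact ((d : ℝ) / 2 < s)]

lemma toC_eq_of_coeff_eq {x : Sob d s} {f : C(UnitAddTorus (Fin d), ℂ)} (h : coeff x = ofFun f) :
    toC x = f := by
  change toCont (coeff x) = f
  rw [h]
  exact toCont_ofFun (h ▸ summable_coeff x)

lemma toC_star (x : Sob d s) (y : UnitAddTorus (Fin d)) :
    toC (star x) y = (starRingEnd ℂ) (toC x y) := by
  have : toC (star x) = star (toC x) := toC_eq_of_coeff_eq (by
    rw [coeff_star, ← ofFun_toC, ← ofFun_conj]; rfl)
  rw [this]; rfl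

/-- Evaluation at a point of the torus as a ring homomorphism on `H^s`, `s > d/2`. -/
def evalHom (y : UnitAddTorus (Fin d)) : Sob d s →+* ℂ where
  toFun x := toC x y
  map_one' := by rw [toC_one]; rfl
  map_mul' x z := by rw [toC_mul]; rfl
  map_zero' := by rw [map_zero]; rfl
  map_add' x z := by rw [map_add]; rfl

/-- Evaluation at a point is a continuous ring homomorphism, hence commutes with the exponential
series. -/
lemma toC_exp (x : Sob d s) (y : UnitAddTorus (Fin d)) :
    toC (NormedSpace.exp x) y = Complex.exp (toC x y) := by
  let _ : NormedAlgebra ℚ (Sob d s) := NormedAlgebra.restrictScalars ℚ ℂ (Sob d s)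
  have hc : Continuous (evalHom (s := s) y) := (ContinuousEvalConst.continuous_eval_const y).comp
    continuous_toC
  rw [Complex.exp_eq_exp_ℂ]
  exact NormedSpace.map_exp (evalHom y) hc x

lemma toC_pot (u v : Sob d s) (y : UnitAddTorus (Fin d)) :
    toC (pot u v) y = potential (toFun (coeff u)) (toFun (coeff v)) y := by
  simp only [pot, map_add, map_smul, toC_mul, ContinuousMap.add_apply, ContinuousMap.smul_apply,
    ContinuousMap.mul_apply, toC_star, Complex.mul_conj, potential, ← toC_apply,
    Complex.normSq_eq_norm_sq]
  push_cast
  rfl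

lemma coeff_phaseIncr (τ : ℝ) (u v : Sob d s) :
    coeff (u + phaseIncr τ u v) = phaseStep τ (coeff u) (coeff v) := by
  rw [← ofFun_toC, phaseStep]
  congr 1
  ext y
  rw [← toC_apply, ← toC_pot]
  have : u + phaseIncr τ u v
      = NormedSpace.exp ((-(τ : ℂ) * (Complex.I / 8)) • pot u v) * u := by
    rw [phaseIncr]; ring
  rw [this, toC_mul, ContinuousMap.mul_apply, toC_exp, map_smul]
  rfl

lemma coeff_cubic (u v : Sob d s) :
    coeff (pot u v * u) = ofFun fun y =>
      potential (toFun (coeff u)) (toFun (coeff v)) y * toFun (coeff u) y := by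
  rw [← ofFun_toC]
  congr 1
  ext y
  rw [← toC_apply, ← toC_pot, toC_mul, ContinuousMap.mul_apply]

/-- The coefficients of the oscillatory terms of the scheme at time `t`. -/
def oscCoeff (n : ℂ) (c τ t : ℝ) : ℂ :=
  Complex.exp (n * Complex.I * c ^ 2 * t) * phiOne (n * Complex.I * c ^ 2 * τ)

lemma coeff_osc (c τ t : ℝ) (u v : Sob d s) :
    coeff (osc (oscCoeff 2 c τ t) (oscCoeff (-2) c τ t) (oscCoeff (-4) c τ t) u v)
      = oscillatory c τ t (coeff u) (coeff v) := by
  rw [← ofFun_toC, oscillatory]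
  congr 1
  ext y
  simp only [osc, map_add, map_smul, toC_mul, ContinuousMap.add_apply, ContinuousMap.smul_apply,
    ContinuousMap.mul_apply, toC_star, Complex.mul_conj, ← toC_apply, Complex.normSq_eq_norm_sq,
    oscCoeff, smul_eq_mul]
  push_cast
  ring

end Algebra

end Sob

end KleinGordon
end

/-! ### Symbol estimates as `c` grows -/

noncomputable section

namespace KleinGordon

variable {d : ℕ}

lemma norm_exp_I_sub_exp_I_le (a b : ℝ) :
    ‖Complex.exp (Complex.I * a) - Complex.exp (Complex.I * b)‖ ≤ |a - b| := by
  have e : Complex.exp (Complex.I * a) - Complex.exp (Complex.I * b)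
      = Complex.exp (Complex.I * b) * (Complex.exp (Complex.I * ((a - b : ℝ) : ℂ)) - 1) := by
    rw [mul_sub, ← Complex.exp_add, mul_one]
    congr 2
    push_cast; ring
  rw [e, norm_mul, Complex.norm_exp_I_mul_ofReal, one_mul]
  exact Real.norm_exp_I_mul_ofReal_sub_one_le

/-- Interpolation between the trivial bound and the full-order one: with `x` of order `c^{-2}` it
trades convergence rate for derivatives, giving `c^{-δ}`. -/
lemma le_two_mul_rpow_of_le {x y δ : ℝ} (hx : 0 ≤ x) (hδ : 0 < δ) (hδ2 : δ ≤ 2) (h2 : y ≤ 2)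
    (hy : y ≤ 2 * x) : y ≤ 2 * x ^ (δ / 2) := by
  rcases le_total x 1 with h | h
  · have : x ^ (1 : ℝ) ≤ x ^ (δ / 2) :=
      Real.rpow_le_rpow_of_exponent_ge_of_imp hx h (by linarith) (fun _ h0 => absurd h0 one_ne_zero)
    rw [Real.rpow_one] at this
    linarith
  · have : 1 ≤ x ^ (δ / 2) := Real.one_le_rpow h (by linarith)
    linarith

lemma bracket_pos {c : ℝ} (hc : 0 < c) (k : Fin d → ℤ) : 0 < bracket c k :=
  Real.sqrt_pos.2 (by have := freqSq_nonneg k; positivity)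

lemma bracket_sq (c : ℝ) (k : Fin d → ℤ) : bracket c k ^ 2 = freqSq k + c ^ 2 :=
  Real.sq_sqrt (by have := freqSq_nonneg k; positivity)

lemma le_bracket {c : ℝ} (k : Fin d → ℤ) : c ≤ bracket c k :=
  Real.le_sqrt_of_sq_le (by linarith [freqSq_nonneg k])

/-- With `b = bracket c k` the difference is exactly `-(b - c)²/2`, and `(b - c)c ≤ b² - c² = |k|²`.
-/
lemma abs_symbolA_sub_le {c : ℝ} (hc : 0 < c) (k : Fin d → ℤ) :
    |symbolA c k - freqSq k / 2| ≤ freqSq k ^ 2 / c ^ 2 := by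
  have hb := bracket_pos hc k
  have hb2 := bracket_sq c k
  have hcb := le_bracket (c := c) k
  have e : symbolA c k - freqSq k / 2 = -((bracket c k - c) ^ 2 / 2) := by
    rw [symbolA, show freqSq k = bracket c k ^ 2 - c ^ 2 by linarith]; ring
  have h1 : (bracket c k - c) * c ≤ freqSq k := by nlinarith
  rw [e, abs_neg, abs_of_nonneg (by positivity), le_div_iff₀ (by positivity)]
  have h2 : ((bracket c k - c) * c) ^ 2 ≤ freqSq k ^ 2 :=
    pow_le_pow_left₀ (mul_nonneg (by linarith) hc.le) h1 2
  nlinarith [sq_nonneg (freqSq k)]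

lemma rpow_div_sq {x c δ : ℝ} (hx : 0 ≤ x) (hc : 0 < c) :
    (x / c ^ 2) ^ (δ / 2) = x ^ (δ / 2) * c ^ (-δ) := by
  rw [Real.div_rpow hx (by positivity), Real.rpow_neg hc.le, ← Real.rpow_natCast c 2,
    ← Real.rpow_mul hc.le, div_eq_mul_inv]
  congr 3
  push_cast; ring

lemma norm_exp_symbolA_sub_le {c δ t : ℝ} (hc : 0 < c) (hδ : 0 < δ) (hδ2 : δ ≤ 2) (ht : 0 ≤ t)
    (ht1 : t ≤ 1) (k : Fin d → ℤ) :
    ‖Complex.exp (Complex.I * ((t * symbolA c k : ℝ) : ℂ))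
      - Complex.exp (Complex.I * ((t * (freqSq k / 2) : ℝ) : ℂ))‖
      ≤ 2 * c ^ (-δ) * (1 + freqSq k) ^ δ := by
  have hq := freqSq_nonneg k
  have h1 : ‖Complex.exp (Complex.I * ((t * symbolA c k : ℝ) : ℂ))
      - Complex.exp (Complex.I * ((t * (freqSq k / 2) : ℝ) : ℂ))‖ ≤ 2 := by
    refine (norm_sub_le _ _).trans ?_
    rw [Complex.norm_exp_I_mul_ofReal, Complex.norm_exp_I_mul_ofReal]; norm_num
  have h0 : 0 ≤ freqSq k ^ 2 / c ^ 2 := by positivity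
  have h2 := norm_exp_I_sub_exp_I_le (t * symbolA c k) (t * (freqSq k / 2))
  have h3 : |t * symbolA c k - t * (freqSq k / 2)| ≤ freqSq k ^ 2 / c ^ 2 := by
    rw [← mul_sub, abs_mul, abs_of_nonneg ht]
    exact (mul_le_of_le_one_left (abs_nonneg _) ht1).trans (abs_symbolA_sub_le hc k)
  have h4 := le_two_mul_rpow_of_le h0 hδ hδ2 h1 ((h2.trans h3).trans (by linarith))
  refine h4.trans ?_
  rw [rpow_div_sq (by positivity) hc, ← Real.rpow_natCast, ← Real.rpow_mul hq,
    show ((2 : ℕ) : ℝ) * (δ / 2) = δ by push_cast; ring]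
  have h5 : freqSq k ^ δ ≤ (1 + freqSq k) ^ δ := Real.rpow_le_rpow hq (by linarith) hδ.le
  have h6 : 0 ≤ c ^ (-δ) := Real.rpow_nonneg hc.le _
  nlinarith

lemma symbolB_mem {c : ℝ} (hc : 0 < c) (k : Fin d → ℤ) :
    0 ≤ c * (bracket c k)⁻¹ ∧ c * (bracket c k)⁻¹ ≤ 1 := by
  have hb := bracket_pos hc k
  refine ⟨by positivity, ?_⟩
  rw [← div_eq_mul_inv, div_le_one hb]
  exact le_bracket k

lemma norm_symbolB_le {c : ℝ} (hc : 0 < c) (k : Fin d → ℤ) : ‖symbolB c k‖ ≤ 1 := by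
  rw [symbolB, Complex.norm_real, Real.norm_of_nonneg (symbolB_mem hc k).1]
  exact (symbolB_mem hc k).2

lemma norm_symbolB_sub_one (c : ℝ) (k : Fin d → ℤ) :
    ‖symbolB c k - 1‖ = |c * (bracket c k)⁻¹ - 1| := by
  rw [symbolB, ← Complex.ofReal_one, ← Complex.ofReal_sub, Complex.norm_real, Real.norm_eq_abs]

lemma norm_symbolB_sub_one_le_one {c : ℝ} (hc : 0 < c) (k : Fin d → ℤ) :
    ‖symbolB c k - 1‖ ≤ 1 := by
  rw [norm_symbolB_sub_one, abs_le]
  constructor <;> linarith [symbolB_mem hc k]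

lemma norm_symbolB_sub_one_le {c δ : ℝ} (hc : 0 < c) (hδ : 0 < δ) (hδ2 : δ ≤ 2)
    (k : Fin d → ℤ) : ‖symbolB c k - 1‖ ≤ 2 * c ^ (-δ) * (1 + freqSq k) ^ δ := by
  have hq := freqSq_nonneg k
  have hb := bracket_pos hc k
  have hb2 := bracket_sq c k
  have hcb := le_bracket (c := c) k
  have h1 := norm_symbolB_sub_one_le_one hc k
  have h2 : ‖symbolB c k - 1‖ ≤ freqSq k / c ^ 2 := by
    rw [norm_symbolB_sub_one, abs_of_nonpos (by linarith [symbolB_mem hc k]),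
      le_div_iff₀ (by positivity)]
    have h3 : (-(c * (bracket c k)⁻¹ - 1)) = (bracket c k - c) / bracket c k := by
      field_simp; ring
    -- Here `1 - c/b = (b - c)/b ≤ |k|²/c²`. Only `δ` derivatives would be lost; the final bound is
    -- weakened to the form shared with the propagators.
    rw [h3, div_mul_eq_mul_div, div_le_iff₀ hb]
    have h4 : (bracket c k - c) * c ≤ freqSq k := by nlinarith
    calc (bracket c k - c) * c ^ 2 = (bracket c k - c) * c * c := by ring
      _ ≤ freqSq k * bracket c k := by gcongr
  have h0 : 0 ≤ freqSq k / c ^ 2 := by positivity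
  refine (le_two_mul_rpow_of_le h0 hδ hδ2 (by linarith) (h2.trans (by linarith))).trans ?_
  rw [rpow_div_sq hq hc]
  have h5 : freqSq k ^ (δ / 2) ≤ (1 + freqSq k) ^ δ :=
    (Real.rpow_le_rpow hq (by linarith : freqSq k ≤ 1 + freqSq k) (by linarith)).trans
      (Real.rpow_le_rpow_of_exponent_le (by linarith) (by linarith))
  have h6 : 0 ≤ c ^ (-δ) := Real.rpow_nonneg hc.le _
  nlinarith

lemma weight_mul_rpow_le {r ρ δ : ℝ} (h : r + 2 * δ ≤ ρ) (k : Fin d → ℤ) :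
    weight r k * (1 + freqSq k) ^ δ ≤ weight ρ k := by
  rw [weight, weight, ← Real.rpow_add (one_add_freqSq_pos k)]
  exact Real.rpow_le_rpow_of_exponent_le (by linarith [freqSq_nonneg k]) (by linarith)

lemma weight_mul_le_of_norm_le {r ρ δ c : ℝ} (h : r + 2 * δ ≤ ρ) (hc : 0 < c)
    {m : (Fin d → ℤ) → ℂ} (hm : ∀ k, ‖m k‖ ≤ 2 * c ^ (-δ) * (1 + freqSq k) ^ δ)
    (k : Fin d → ℤ) : weight r k * ‖m k‖ ≤ 2 * c ^ (-δ) * weight ρ k := by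
  have h6 : 0 ≤ c ^ (-δ) := Real.rpow_nonneg hc.le _
  have h1 := weight_mul_rpow_le h k
  have h2 := weight_pos r k
  calc weight r k * ‖m k‖ ≤ weight r k * (2 * c ^ (-δ) * (1 + freqSq k) ^ δ) := by
        gcongr; exact hm k
    _ = 2 * c ^ (-δ) * (weight r k * (1 + freqSq k) ^ δ) := by ring
    _ ≤ _ := by gcongr

lemma norm_phiOne_le_one (y : ℝ) : ‖phiOne (Complex.I * y)‖ ≤ 1 := by
  have := intervalIntegral.norm_integral_le_of_norm_le_const (a := (0 : ℝ)) (b := 1) (C := 1)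
    (f := fun θ : ℝ => Complex.exp ((1 - (θ : ℂ)) * (Complex.I * y))) (fun θ _ => by
      rw [show (1 - (θ : ℂ)) * (Complex.I * y) = Complex.I * (((1 - θ) * y : ℝ) : ℂ) by
        push_cast; ring, Complex.norm_exp_I_mul_ofReal])
  simpa [phiOne] using this

/-- Averaging a full oscillation: `φ₁(z) = (e^z - 1)/z` with a numerator of modulus at most `2`. -/
lemma norm_phiOne_le_div {y : ℝ} (hy : y ≠ 0) : ‖phiOne (Complex.I * y)‖ ≤ 2 / |y| := by
  have hz : -(Complex.I * (y : ℂ)) ≠ 0 := by simp [hy]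
  have e : phiOne (Complex.I * y) = Complex.exp (Complex.I * y) *
      ((Complex.exp (-(Complex.I * y)) - 1) / -(Complex.I * y)) := by
    have h1 := integral_exp_mul_complex (a := 0) (b := 1) hz
    simp only [Complex.ofReal_one, mul_one, Complex.ofReal_zero, mul_zero, Complex.exp_zero] at h1
    rw [← h1, ← intervalIntegral.integral_const_mul, phiOne]
    refine intervalIntegral.integral_congr fun θ _ => ?_
    rw [← Complex.exp_add]
    congr 1; ring
  have h2 : ‖Complex.exp (-(Complex.I * y)) - 1‖ ≤ 2 := by
    refine (norm_sub_le _ _).trans ?_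
    rw [show -(Complex.I * (y : ℂ)) = Complex.I * ((-y : ℝ) : ℂ) by push_cast; ring,
      Complex.norm_exp_I_mul_ofReal]
    norm_num
  rw [e, norm_mul, Complex.norm_exp_I_mul_ofReal, one_mul, norm_div, norm_neg, norm_mul,
    Complex.norm_I, one_mul, Complex.norm_real, Real.norm_eq_abs]
  gcongr

lemma norm_oscCoeff_eq (n c τ t : ℝ) :
    ‖Sob.oscCoeff n c τ t‖ = ‖phiOne (Complex.I * ((n * c ^ 2 * τ : ℝ) : ℂ))‖ := by
  rw [Sob.oscCoeff, norm_mul]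
  have : (n : ℂ) * Complex.I * c ^ 2 * t = Complex.I * ((n * c ^ 2 * t : ℝ) : ℂ) := by
    push_cast; ring
  rw [this, Complex.norm_exp_I_mul_ofReal, one_mul]
  congr 2
  push_cast; ring

lemma norm_oscCoeff_le_one (n c τ t : ℝ) : ‖Sob.oscCoeff n c τ t‖ ≤ 1 := by
  rw [norm_oscCoeff_eq]; exact norm_phiOne_le_one _

/-- The averaging factors are of size `c^{-δ}` if the step size is at least `c^{δ-2}`. -/
lemma norm_oscCoeff_le {n c τ δ : ℝ} (hn : 2 ≤ |n|) (hc : 0 < c) (hτ : 0 < τ)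
    (h : 1 ≤ τ * c ^ (2 - δ)) (t : ℝ) : ‖Sob.oscCoeff n c τ t‖ ≤ c ^ (-δ) := by
  have hn0 : n ≠ 0 := by rintro rfl; norm_num at hn
  have hne : n * c ^ 2 * τ ≠ 0 := by positivity
  rw [norm_oscCoeff_eq]
  refine (norm_phiOne_le_div hne).trans ?_
  rw [div_le_iff₀ (abs_pos.2 hne), abs_mul, abs_mul, abs_of_pos hτ,
    abs_of_pos (by positivity : 0 < c ^ 2)]
  -- The step condition becomes `τ c² c^{-δ} ≥ 1`, and `|n| ≥ 2` cancels the `2` from `φ₁`.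
  have e : c ^ (2 - δ) = c ^ (-δ) * c ^ 2 := by
    rw [← Real.rpow_natCast c 2, ← Real.rpow_add hc]; congr 1; push_cast; ring
  rw [e] at h
  calc (2 : ℝ) ≤ |n| * (τ * (c ^ (-δ) * c ^ 2)) := by nlinarith
    _ = _ := by ring

/-- For `c < 1` the step condition would force `τ ≥ 1`. So small `c` needs no separate treatment. -/
lemma one_le_of_step_bound {c τ δ : ℝ} (hc : 0 < c) (hδ2 : δ ≤ 2) (hτ : 0 < τ) (hτ2 : τ ≤ 1 / 2)
    (h : 1 ≤ τ * c ^ (2 - δ)) : 1 ≤ c := by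
  by_contra hlt
  have : c ^ (2 - δ) ≤ 1 := Real.rpow_le_one hc.le (le_of_not_ge hlt) (by linarith)
  nlinarith

end KleinGordon
end

/-! ### Recursions, and the two methods as sequences in `H^s` -/

noncomputable section

namespace KleinGordon

variable {d : ℕ} {s : ℝ}

/-- On so short a time interval, earlier values at most `2A` contribute at most `A` through the sum,
so the bound `2A` reproduces itself. -/
lemma le_of_discrete_gronwall {D : ℕ → ℝ} {A ℓ τ : ℝ} (hℓ : 0 ≤ ℓ) (hτ : 0 ≤ τ) (hA : 0 ≤ A)
    {N : ℕ} (hN : 2 * (ℓ * (N * τ)) ≤ 1)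
    (h : ∀ n ≤ N, D n ≤ A + ℓ * τ * ∑ j ∈ Finset.range n, D j) : ∀ n ≤ N, D n ≤ 2 * A := by
  intro n
  induction n using Nat.strong_induction_on with
  | _ n ih =>
    intro hn
    have h1 : ∑ j ∈ Finset.range n, D j ≤ n * (2 * A) := by
      have := Finset.sum_le_card_nsmul (Finset.range n) D (2 * A) fun j hj =>
        ih j (Finset.mem_range.1 hj) ((Finset.mem_range.1 hj).le.trans hn)
      simpa using this
    have h2 : (n : ℝ) ≤ N := by exact_mod_cast hn
    calc D n ≤ A + ℓ * τ * ∑ j ∈ Finset.range n, D j := h n hn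
      _ ≤ A + ℓ * τ * (N * (2 * A)) := by
          gcongr
          exact h1.trans (by gcongr)
      _ = A + 2 * (ℓ * (N * τ)) * A := by ring
      _ ≤ A + 1 * A := by gcongr
      _ = _ := by ring

/-- Bootstrap: inside the ball of radius `R + 1` growth is at most linear with rate `B`, so the ball
is not left before time `1/B`. -/
lemma norm_le_of_recursion {H : Type*} [NormedAddCommGroup H] {x y : ℕ → H} {R B τ : ℝ} (hB : 0 ≤ B) (hτ : 0 ≤ τ) (hx0 : ‖x 0‖ ≤ R)
    (hy0 : ‖y 0‖ ≤ R)
    (h : ∀ n, ‖x n‖ ≤ R + 1 → ‖y n‖ ≤ R + 1 →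
      ‖x (n + 1)‖ ≤ ‖x n‖ + τ * B ∧ ‖y (n + 1)‖ ≤ ‖y n‖ + τ * B)
    (n : ℕ) (hn : n * τ * B ≤ 1) : ‖x n‖ ≤ R + 1 ∧ ‖y n‖ ≤ R + 1 := by
  have key : ∀ n : ℕ, n * τ * B ≤ 1 → ‖x n‖ ≤ R + n * τ * B ∧ ‖y n‖ ≤ R + n * τ * B := by
    intro n
    induction n with
    | zero => intro _; simpa using ⟨hx0, hy0⟩
    | succ n ih =>
      intro hn
      push_cast at hn ⊢
      have h0 : 0 ≤ τ * B := mul_nonneg hτ hB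
      have hn' : n * τ * B ≤ 1 := by nlinarith
      obtain ⟨h1, h2⟩ := ih hn'
      obtain ⟨h3, h4⟩ := h n (by linarith) (by linarith)
      constructor <;> nlinarith
  obtain ⟨h1, h2⟩ := key n hn
  constructor <;> linarith

section Recursion

variable {H : Type*} [NormedAddCommGroup H] [NormedSpace ℂ H]

/-- The exponent is `n - j`, not `n - 1 - j`, because the increment is added before `E` acts. -/
lemma duhamel {E : H →ₗ[ℂ] H} {x g : ℕ → H} (h : ∀ n, x (n + 1) = E (x n + g n)) (n : ℕ) :
    x n = (E ^ n) (x 0) + ∑ j ∈ Finset.range n, (E ^ (n - j)) (g j) := by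
  induction n with
  | zero => simp
  | succ n ih =>
    rw [h, Finset.sum_range_succ, map_add]
    conv_lhs => rw [ih]
    rw [map_add, map_sum, add_assoc, Nat.add_sub_cancel_left, pow_one, pow_succ', Module.End.mul_apply]
    congr 2
    refine Finset.sum_congr rfl fun j hj => ?_
    rw [Nat.sub_add_comm (Finset.mem_range.1 hj).le, pow_succ', Module.End.mul_apply]

lemma norm_pow_apply_le {L : H →ₗ[ℂ] H} (hL : ∀ z, ‖L z‖ ≤ ‖z‖) (n : ℕ) (z : H) :
    ‖(L ^ n) z‖ ≤ ‖z‖ := by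
  induction n with
  | zero => simp
  | succ n ih => rw [pow_succ', Module.End.mul_apply]; exact (hL _).trans ih

/-- Comparing whole powers avoids adding up `n` one-step propagator errors. Differences of powers
act only on `x 0` and `g`, the sequence that will have extra regularity; `y` and `h` meet only the
contraction `L`. -/
lemma norm_sub_le_of_recursion {E L : H →ₗ[ℂ] H} (hL : ∀ z, ‖L z‖ ≤ ‖z‖) {x g y h : ℕ → H}
    (hx : ∀ n, x (n + 1) = E (x n + g n)) (hy : ∀ n, y (n + 1) = L (y n + h n)) (n : ℕ) :
    ‖x n - y n‖ ≤ ‖(E ^ n) (x 0) - (L ^ n) (x 0)‖ + ‖x 0 - y 0‖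
      + ∑ j ∈ Finset.range n, (‖(E ^ (n - j)) (g j) - (L ^ (n - j)) (g j)‖ + ‖g j - h j‖) := by
  have e : x n - y n = ((E ^ n) (x 0) - (L ^ n) (x 0)) + (L ^ n) (x 0 - y 0)
      + ∑ j ∈ Finset.range n, (((E ^ (n - j)) (g j) - (L ^ (n - j)) (g j))
        + (L ^ (n - j)) (g j - h j)) := by
    rw [duhamel hx n, duhamel hy n]
    simp only [map_sub, Finset.sum_add_distrib, Finset.sum_sub_distrib]
    abel
  rw [e]
  refine (norm_add_le _ _).trans (add_le_add ((norm_add_le _ _).trans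
    (by gcongr; exact norm_pow_apply_le hL _ _)) ?_)
  refine (norm_sum_le _ _).trans (Finset.sum_le_sum fun j _ => (norm_add_le _ _).trans ?_)
  gcongr
  exact norm_pow_apply_le hL _ _

end Recursion

lemma norm_symbolExpA (c τ : ℝ) (k : Fin d → ℤ) : ‖symbolExpA c τ k‖ = 1 :=
  Complex.norm_exp_I_mul_ofReal _

lemma symbolExpLaplace_eq (τ : ℝ) (k : Fin d → ℤ) :
    symbolExpLaplace τ k = Complex.exp (Complex.I * ((τ * (freqSq k / 2) : ℝ) : ℂ)) := by
  rw [symbolExpLaplace]; congr 1; push_cast; ring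

lemma norm_symbolExpLaplace (τ : ℝ) (k : Fin d → ℤ) : ‖symbolExpLaplace τ k‖ = 1 := by
  rw [symbolExpLaplace_eq]; exact Complex.norm_exp_I_mul_ofReal _

lemma symbolExpA_pow (c τ : ℝ) (n : ℕ) (k : Fin d → ℤ) :
    symbolExpA c τ k ^ n = Complex.exp (Complex.I * ((n * τ * symbolA c k : ℝ) : ℂ)) := by
  rw [symbolExpA, ← Complex.exp_nat_mul]; congr 1; push_cast; ring

lemma symbolExpLaplace_pow (τ : ℝ) (n : ℕ) (k : Fin d → ℤ) :
    symbolExpLaplace τ k ^ n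
      = Complex.exp (Complex.I * ((n * τ * (freqSq k / 2) : ℝ) : ℂ)) := by
  rw [symbolExpLaplace_eq, ← Complex.exp_nat_mul]; congr 1; push_cast; ring

namespace Sob

lemma coeff_mulOp_pow (m : (Fin d → ℤ) → ℂ) (hm : ∀ k, ‖m k‖ ≤ 1) (n : ℕ) (x : Sob d s) :
    coeff ((mulOp m hm ^ n) x) = multiplier (fun k => m k ^ n) (coeff x) := by
  induction n with
  | zero => ext k; simp [multiplier]
  | succ n ih =>
    rw [pow_succ', Module.End.mul_apply, coeff_mulOp, ih]
    ext k
    simp only [multiplier]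
    ring

/-- The propagator `e^{iτ𝒜_c}`. -/
def propA (c τ : ℝ) : Sob d s →ₗ[ℂ] Sob d s :=
  mulOp (symbolExpA c τ) fun k => (norm_symbolExpA c τ k).le

/-- The propagator `e^{-iτΔ/2}`. -/
def propLaplace (τ : ℝ) : Sob d s →ₗ[ℂ] Sob d s :=
  mulOp (symbolExpLaplace τ) fun k => (norm_symbolExpLaplace τ k).le

/-- The powers of the two propagators differ by `O(c^{-δ})` from `H^ρ` to `H^r`. -/
lemma norm_prop_pow_sub_le {r ρ c δ τ : ℝ} (hρ : r + 2 * δ ≤ ρ) (hc : 0 < c) (hδ : 0 < δ)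
    (hδ2 : δ ≤ 2) (hτ : 0 ≤ τ) {n : ℕ} (hn : n * τ ≤ 1) {x : Sob d r} {y : Sob d ρ}
    (h : coeff x = coeff y) :
    ‖(propA c τ ^ n) x - (propLaplace τ ^ n) x‖
      ≤ 2 * c ^ (-δ) * (algConst d r / algConst d ρ * ‖y‖) := by
  refine norm_le_of_coeff_eq_multiplier (by positivity) (weight_mul_le_of_norm_le hρ hc
    (m := fun k => symbolExpA c τ k ^ n - symbolExpLaplace τ k ^ n) fun k => ?_) ?_
  · rw [symbolExpA_pow, symbolExpLaplace_pow]
    exact norm_exp_symbolA_sub_le hc hδ hδ2 (by positivity) hn k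
  · rw [map_sub, propA, propLaplace, coeff_mulOp_pow, coeff_mulOp_pow, h]
    ext k
    simp only [multiplier, Pi.sub_apply]
    ring

section Algebra

variable [hs : Fact ((d : ℝ) / 2 < s)]

/-- The increment of the scheme before the propagator is applied. -/
def schemeIncr {c : ℝ} (hc : 0 < c) (τ t : ℝ) (u v : Sob d s) : Sob d s :=
  phaseIncr τ u v - ((τ : ℂ) * (Complex.I / 8)) •
    (mulOp (fun k => symbolB c k - 1) (norm_symbolB_sub_one_le_one hc) (pot u v * u)
      + mulOp (symbolB c) (norm_symbolB_le hc)
        (osc (oscCoeff 2 c τ t) (oscCoeff (-2) c τ t) (oscCoeff (-4) c τ t) u v))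

lemma coeff_schemeIncr {c : ℝ} (hc : 0 < c) (τ t : ℝ) (u v : Sob d s) :
    coeff (schemeIncr hc τ t u v) = phaseStep τ (coeff u) (coeff v) - coeff u
      - ((τ : ℂ) * (Complex.I / 8)) •
        (multiplier (fun k => symbolB c k - 1) (ofFun fun y =>
            potential (toFun (coeff u)) (toFun (coeff v)) y * toFun (coeff u) y)
          + multiplier (symbolB c) (oscillatory c τ t (coeff u) (coeff v))) := by
  rw [schemeIncr, map_sub, map_smul, map_add, coeff_mulOp, coeff_mulOp, coeff_cubic, coeff_osc,
    ← coeff_phaseIncr, map_add, add_sub_cancel_left]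

lemma coeff_propA_add_schemeIncr {c : ℝ} (hc : 0 < c) (τ t : ℝ) (u v : Sob d s) :
    coeff (propA c τ (u + schemeIncr hc τ t u v)) = schemeStep c τ t (coeff u) (coeff v) := by
  rw [propA, coeff_mulOp, map_add, coeff_schemeIncr, schemeStep]
  ext k
  simp only [multiplier, Pi.add_apply, Pi.sub_apply, Pi.smul_apply, smul_eq_mul]
  ring

lemma coeff_propLaplace_add_phaseIncr (τ : ℝ) (u v : Sob d s) :
    coeff (propLaplace τ (u + phaseIncr τ u v)) = lieStep τ (coeff u) (coeff v) := by
  rw [propLaplace, coeff_mulOp, coeff_phaseIncr, lieStep]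

/-- The bound of `τ⁻¹ • schemeIncr` on the ball of radius `R`. -/
def incrBound (R : ℝ) : ℝ := R ^ 3 * Real.exp (R ^ 2) + R ^ 3

lemma norm_step_factor {τ : ℝ} (hτ : 0 ≤ τ) : ‖(τ : ℂ) * (Complex.I / 8)‖ = τ / 8 := by
  rw [norm_mul, Complex.norm_real, Real.norm_of_nonneg hτ, norm_div, Complex.norm_I]
  norm_num; ring

lemma norm_schemeIncr_le {c τ R : ℝ} (hc : 0 < c) (hτ : 0 ≤ τ) (hτ1 : τ ≤ 1) (t : ℝ)
    {u v : Sob d s} (hu : ‖u‖ ≤ R) (hv : ‖v‖ ≤ R) :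
    ‖schemeIncr hc τ t u v‖ ≤ τ * incrBound R := by
  have h1 := norm_phaseIncr_le hτ hτ1 hu hv
  have h2 := (norm_mulOp_le (fun k => symbolB c k - 1) (norm_symbolB_sub_one_le_one hc)
    (pot u v * u)).trans (norm_cubic_le hu hv)
  have h3 := (norm_mulOp_le (symbolB c) (norm_symbolB_le hc) _).trans
    (norm_osc_le (p := 1) hu hv (by simpa using norm_oscCoeff_le_one 2 c τ t)
      (by simpa using norm_oscCoeff_le_one (-2) c τ t)
      (by simpa using norm_oscCoeff_le_one (-4) c τ t))
  refine (norm_sub_le _ _).trans ?_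
  rw [norm_smul, norm_step_factor hτ]
  -- The prefactor `1/8` cancels `3 + 5`, which gives the second summand of `incrBound`.
  calc _ ≤ τ * (R ^ 3 * Real.exp (R ^ 2)) + τ / 8 * (3 * R ^ 3 + 5 * R ^ 3 * 1) := by
        gcongr
        exact (norm_add_le _ _).trans (add_le_add h2 h3)
    _ = _ := by rw [incrBound]; ring

/-- The iterates of the scheme as elements of `H^s`. -/
def schemeSeq {c : ℝ} (hc : 0 < c) (τ : ℝ) (u₀ v₀ : Sob d s) : ℕ → Sob d s × Sob d s
  | 0 => (u₀, v₀)
  | n + 1 =>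
      let w := schemeSeq hc τ u₀ v₀ n
      (propA c τ (w.1 + schemeIncr hc τ (n * τ) w.1 w.2),
        propA c τ (w.2 + schemeIncr hc τ (n * τ) w.2 w.1))

/-- The iterates of the Lie splitting as elements of `H^s`. -/
def lieSeq (τ : ℝ) (u₀ v₀ : Sob d s) : ℕ → Sob d s × Sob d s
  | 0 => (u₀, v₀)
  | n + 1 =>
      let w := lieSeq τ u₀ v₀ n
      (propLaplace τ (w.1 + phaseIncr τ w.1 w.2), propLaplace τ (w.2 + phaseIncr τ w.2 w.1))

lemma coeff_schemeSeq {c τ : ℝ} (hc : 0 < c) {z0 z1 : PerDist d} {u₀ v₀ : Sob d s}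
    (hu : coeff u₀ = (scheme c τ z0 z1 0).1) (hv : coeff v₀ = (scheme c τ z0 z1 0).2) (n : ℕ) :
    coeff (schemeSeq hc τ u₀ v₀ n).1 = (scheme c τ z0 z1 n).1
      ∧ coeff (schemeSeq hc τ u₀ v₀ n).2 = (scheme c τ z0 z1 n).2 := by
  induction n with
  | zero => exact ⟨hu, hv⟩
  | succ n ih =>
    simp only [schemeSeq, scheme, coeff_propA_add_schemeIncr, ih, and_self]

lemma coeff_lieSeq {τ : ℝ} {γ φ : PerDist d} {u₀ v₀ : Sob d s}
    (hu : coeff u₀ = (lie τ γ φ 0).1) (hv : coeff v₀ = (lie τ γ φ 0).2) (n : ℕ) :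
    coeff (lieSeq τ u₀ v₀ n).1 = (lie τ γ φ n).1
      ∧ coeff (lieSeq τ u₀ v₀ n).2 = (lie τ γ φ n).2 := by
  induction n with
  | zero => exact ⟨hu, hv⟩
  | succ n ih =>
    simp only [lieSeq, lie, coeff_propLaplace_add_phaseIncr, ih, and_self]

lemma norm_schemeSeq_le {c τ R : ℝ} (hc : 0 < c) (hτ : 0 ≤ τ) (hτ1 : τ ≤ 1) {u₀ v₀ : Sob d s}
    (hu : ‖u₀‖ ≤ R) (hv : ‖v₀‖ ≤ R) {n : ℕ} (hn : n * τ * incrBound (R + 1) ≤ 1) :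
    ‖(schemeSeq hc τ u₀ v₀ n).1‖ ≤ R + 1 ∧ ‖(schemeSeq hc τ u₀ v₀ n).2‖ ≤ R + 1 := by
  have hR : 0 ≤ R := (norm_nonneg _).trans hu
  refine norm_le_of_recursion (x := fun n => (schemeSeq hc τ u₀ v₀ n).1)
    (y := fun n => (schemeSeq hc τ u₀ v₀ n).2) (by unfold incrBound; positivity) hτ hu hv
    (fun n h1 h2 => ⟨?_, ?_⟩) n hn
  · exact (norm_mulOp_le _ _ _).trans ((norm_add_le _ _).trans
      (by gcongr; exact norm_schemeIncr_le hc hτ hτ1 _ h1 h2))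
  · exact (norm_mulOp_le _ _ _).trans ((norm_add_le _ _).trans
      (by gcongr; exact norm_schemeIncr_le hc hτ hτ1 _ h2 h1))

lemma norm_lieSeq_le {τ R : ℝ} (hτ : 0 ≤ τ) (hτ1 : τ ≤ 1) {u₀ v₀ : Sob d s}
    (hu : ‖u₀‖ ≤ R) (hv : ‖v₀‖ ≤ R) {n : ℕ} (hn : n * τ * incrBound (R + 1) ≤ 1) :
    ‖(lieSeq τ u₀ v₀ n).1‖ ≤ R + 1 ∧ ‖(lieSeq τ u₀ v₀ n).2‖ ≤ R + 1 := by
  have hR : 0 ≤ R := (norm_nonneg _).trans hu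
  have hB : ∀ u v : Sob d s, ‖u‖ ≤ R + 1 → ‖v‖ ≤ R + 1 →
      ‖phaseIncr τ u v‖ ≤ τ * incrBound (R + 1) := fun u v h1 h2 =>
    (norm_phaseIncr_le hτ hτ1 h1 h2).trans (by
      unfold incrBound
      gcongr
      have : 0 ≤ (R + 1) ^ 3 := by positivity
      linarith)
  refine norm_le_of_recursion (x := fun n => (lieSeq τ u₀ v₀ n).1)
    (y := fun n => (lieSeq τ u₀ v₀ n).2) (by unfold incrBound; positivity) hτ hu hv
    (fun n h1 h2 => ⟨?_, ?_⟩) n hn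
  · exact (norm_mulOp_le _ _ _).trans ((norm_add_le _ _).trans
      (by gcongr; exact hB _ _ h1 h2))
  · exact (norm_mulOp_le _ _ _).trans ((norm_add_le _ _).trans
      (by gcongr; exact hB _ _ h2 h1))

end Algebra

end Sob

end KleinGordon
end

/-! ### Error recursion between the scheme and the Lie splitting -/

noncomputable section

namespace KleinGordon

variable {d : ℕ}

namespace Sob

section Convergence

variable {r ρ : ℝ} [hr : Fact ((d : ℝ) / 2 < r)] [hρ : Fact ((d : ℝ) / 2 < ρ)]

/-- The increment depends on the Fourier coefficients alone, so an `H^r` increment can be measured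
through its `H^ρ` copy. -/
lemma coeff_schemeIncr_congr {c : ℝ} (hc : 0 < c) (τ t : ℝ) {u v : Sob d r} {u' v' : Sob d ρ}
    (hu : coeff u = coeff u') (hv : coeff v = coeff v') :
    coeff (schemeIncr hc τ t u v) = coeff (schemeIncr hc τ t u' v') := by
  rw [coeff_schemeIncr, coeff_schemeIncr, hu, hv]

/-- The phase parts give the Lipschitz term. The `symbolB c k - 1` correction is small by the `H^ρ`
bounds, the oscillatory terms by the step condition. -/
lemma norm_schemeIncr_sub_phaseIncr_le {c δ τ R : ℝ} (h : r + 2 * δ ≤ ρ) (hc : 0 < c)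
    (hδ : 0 < δ) (hδ2 : δ ≤ 2) (hτ : 0 < τ) (hτ1 : τ ≤ 1) (hstep : 1 ≤ τ * c ^ (2 - δ)) (t : ℝ)
    {u v w z : Sob d r} {u' v' : Sob d ρ} (huu : coeff u = coeff u') (hvv : coeff v = coeff v')
    (hu : ‖u‖ ≤ R) (hv : ‖v‖ ≤ R) (hw : ‖w‖ ≤ R) (hz : ‖z‖ ≤ R) (hu' : ‖u'‖ ≤ R)
    (hv' : ‖v'‖ ≤ R) :
    ‖schemeIncr hc τ t u v - phaseIncr τ w z‖ ≤ τ * (phaseLip R * (‖u - w‖ + ‖v - z‖))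
      + τ * c ^ (-δ) * ((algConst d r / algConst d ρ + 1) * R ^ 3) := by
  have hR : 0 ≤ R := (norm_nonneg u).trans hu
  have hκ : 0 < algConst d r / algConst d ρ := div_pos (algConst_pos d r) (algConst_pos d ρ)
  have hη : 0 ≤ c ^ (-δ) := Real.rpow_nonneg hc.le _
  have h1 := norm_phaseIncr_sub_le hτ.le hτ1 hu hv hw hz
  have h2 : ‖mulOp (fun k => symbolB c k - 1) (norm_symbolB_sub_one_le_one hc) (pot u v * u)‖
      ≤ 2 * c ^ (-δ) * (algConst d r / algConst d ρ * (3 * R ^ 3)) := by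
    refine (norm_le_of_coeff_eq_multiplier (y := pot u' v' * u') (by positivity)
      (weight_mul_le_of_norm_le h hc (norm_symbolB_sub_one_le hc hδ hδ2)) ?_).trans ?_
    · rw [coeff_mulOp, coeff_cubic, coeff_cubic, huu, hvv]
    · gcongr
      exact norm_cubic_le hu' hv'
  have h3 := (norm_mulOp_le (symbolB c) (norm_symbolB_le hc) _).trans
    (norm_osc_le (p := c ^ (-δ)) hu hv
      (by simpa using norm_oscCoeff_le (n := 2) (by norm_num) hc hτ hstep t)
      (by simpa using norm_oscCoeff_le (n := -2) (by norm_num) hc hτ hstep t)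
      (by simpa using norm_oscCoeff_le (n := -4) (by norm_num) hc hτ hstep t))
  rw [schemeIncr, sub_right_comm]
  refine (norm_sub_le _ _).trans (add_le_add h1 ?_)
  rw [norm_smul, norm_step_factor hτ.le]
  have h4 : 0 ≤ τ * c ^ (-δ) * R ^ 3 := by positivity
  have h5 := mul_nonneg h4 hκ.le
  calc _ ≤ τ / 8 * (2 * c ^ (-δ) * (algConst d r / algConst d ρ * (3 * R ^ 3))
        + 5 * R ^ 3 * c ^ (-δ)) := by
        gcongr
        exact (norm_add_le _ _).trans (add_le_add h2 h3)
    _ ≤ _ := by nlinarith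

/-- The constant in the error recursion. -/
def errConst (d : ℕ) (r ρ R A : ℝ) : ℝ :=
  2 * (algConst d r / algConst d ρ * R) + A + 2 * (algConst d r / algConst d ρ * incrBound R)
    + (algConst d r / algConst d ρ + 1) * R ^ 3

/-- The summands of `errConst` are, in order: propagators on the initial data, initial error,
propagators on the increments, and inconsistency of the increments. -/
lemma component_error_le {c δ τ R A : ℝ} (h : r + 2 * δ ≤ ρ) (hc : 0 < c)
    (hδ : 0 < δ) (hδ2 : δ ≤ 2) (hτ : 0 < τ) (hτ1 : τ ≤ 1) (hstep : 1 ≤ τ * c ^ (2 - δ))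
    {n : ℕ} (hn : n * τ ≤ 1) {u v w z : ℕ → Sob d r} {u' v' : ℕ → Sob d ρ}
    (huu : ∀ j, coeff (u j) = coeff (u' j)) (hvv : ∀ j, coeff (v j) = coeff (v' j))
    (hb : ∀ j ≤ n, ‖u j‖ ≤ R ∧ ‖v j‖ ≤ R ∧ ‖w j‖ ≤ R ∧ ‖z j‖ ≤ R ∧ ‖u' j‖ ≤ R ∧ ‖v' j‖ ≤ R)
    (hu : ∀ j : ℕ, u (j + 1) = propA c τ (u j + schemeIncr hc τ (j * τ) (u j) (v j)))
    (hw : ∀ j : ℕ, w (j + 1) = propLaplace τ (w j + phaseIncr τ (w j) (z j)))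
    (h0 : ‖u 0 - w 0‖ ≤ A * c ^ (-δ)) :
    ‖u n - w n‖ ≤ errConst d r ρ R A * c ^ (-δ)
      + phaseLip R * τ * ∑ j ∈ Finset.range n, (‖u j - w j‖ + ‖v j - z j‖) := by
  have hR : 0 ≤ R := (norm_nonneg _).trans (hb 0 n.zero_le).1
  have hκ : 0 < algConst d r / algConst d ρ := div_pos (algConst_pos d r) (algConst_pos d ρ)
  set κ := algConst d r / algConst d ρ with hκdef
  set η := c ^ (-δ) with hηdef
  have hη : 0 ≤ η := Real.rpow_nonneg hc.le _
  have hB : 0 ≤ incrBound R := by unfold incrBound; positivity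
  have key := norm_sub_le_of_recursion (L := propLaplace τ) (fun z => norm_mulOp_le _ _ z) hu hw n
  have h1 : ‖(propA c τ ^ n) (u 0) - (propLaplace τ ^ n) (u 0)‖ ≤ 2 * η * (κ * R) :=
    (norm_prop_pow_sub_le h hc hδ hδ2 hτ.le hn (huu 0)).trans (by
      rw [← hκdef]
      gcongr
      exact (hb 0 n.zero_le).2.2.2.2.1)
  have h2 : ∀ j ∈ Finset.range n,
      ‖(propA c τ ^ (n - j)) (schemeIncr hc τ (j * τ) (u j) (v j))
          - (propLaplace τ ^ (n - j)) (schemeIncr hc τ (j * τ) (u j) (v j))‖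
        + ‖schemeIncr hc τ (j * τ) (u j) (v j) - phaseIncr τ (w j) (z j)‖
      ≤ τ * (2 * η * (κ * incrBound R) + η * ((κ + 1) * R ^ 3))
        + phaseLip R * τ * (‖u j - w j‖ + ‖v j - z j‖) := by
    intro j hj
    obtain ⟨b1, b2, b3, b4, b5, b6⟩ := hb j (Finset.mem_range.1 hj).le
    have hnj : ((n - j : ℕ) : ℝ) * τ ≤ 1 := by
      refine le_trans ?_ hn
      gcongr
      exact Nat.sub_le n j
    have e1 := norm_prop_pow_sub_le h hc hδ hδ2 hτ.le hnj
      (coeff_schemeIncr_congr hc τ (j * τ) (huu j) (hvv j))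
    have e2 : ‖schemeIncr hc τ (j * τ) (u' j) (v' j)‖ ≤ τ * incrBound R :=
      norm_schemeIncr_le hc hτ.le hτ1 _ b5 b6
    have e3 := norm_schemeIncr_sub_phaseIncr_le h hc hδ hδ2 hτ hτ1 hstep (j * τ) (huu j) (hvv j)
      b1 b2 b3 b4 b5 b6
    rw [← hκdef, ← hηdef] at e1 e3
    have e4 : 2 * η * (κ * ‖schemeIncr hc τ (j * τ) (u' j) (v' j)‖)
        ≤ 2 * η * (κ * (τ * incrBound R)) := by gcongr
    linarith
  have h3 := key.trans (add_le_add_right (Finset.sum_le_sum h2) _)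
  rw [Finset.sum_add_distrib (s := Finset.range n) (f := fun _ => τ * _), Finset.sum_const, Finset.card_range,
    nsmul_eq_mul, ← Finset.mul_sum] at h3
  -- Each local error carries a factor `τ`, and `nτ ≤ 1`, so their sum has no loss.
  have h4 : n * (τ * (2 * η * (κ * incrBound R) + η * ((κ + 1) * R ^ 3)))
      ≤ 2 * η * (κ * incrBound R) + η * ((κ + 1) * R ^ 3) := by
    rw [← mul_assoc]
    exact mul_le_of_le_one_left (by positivity) hn
  rw [errConst, ← hκdef]
  linarith

/-- The scheme and the Lie splitting stay `O(c^{-δ})`-close as long as both are bounded. -/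
lemma error_le {c δ τ R A : ℝ} (h : r + 2 * δ ≤ ρ) (hc : 0 < c)
    (hδ : 0 < δ) (hδ2 : δ ≤ 2) (hτ : 0 < τ) (hτ1 : τ ≤ 1) (hstep : 1 ≤ τ * c ^ (2 - δ))
    (hR : 0 ≤ R) (hA : 0 ≤ A) {u₀ v₀ w₀ z₀ : Sob d r} {u₀' v₀' : Sob d ρ}
    (huu : coeff u₀ = coeff u₀') (hvv : coeff v₀ = coeff v₀')
    (bu : ‖u₀‖ ≤ R) (bv : ‖v₀‖ ≤ R) (bw : ‖w₀‖ ≤ R) (bz : ‖z₀‖ ≤ R) (bu' : ‖u₀'‖ ≤ R)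
    (bv' : ‖v₀'‖ ≤ R) (hu0 : ‖u₀ - w₀‖ ≤ A * c ^ (-δ)) (hv0 : ‖v₀ - z₀‖ ≤ A * c ^ (-δ))
    {N : ℕ} (hN : N * τ * (1 + incrBound (R + 1) + 4 * phaseLip (R + 1)) ≤ 1) :
    ‖(schemeSeq hc τ u₀ v₀ N).1 - (lieSeq τ w₀ z₀ N).1‖
      + ‖(schemeSeq hc τ u₀ v₀ N).2 - (lieSeq τ w₀ z₀ N).2‖
      ≤ 4 * errConst d r ρ (R + 1) A * c ^ (-δ) := by
  have hη : 0 ≤ c ^ (-δ) := Real.rpow_nonneg hc.le _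
  have hB : 0 ≤ incrBound (R + 1) := by unfold incrBound; positivity
  have hℓ : 0 ≤ phaseLip (R + 1) := by unfold phaseLip; positivity
  have hκ : 0 < algConst d r / algConst d ρ := div_pos (algConst_pos d r) (algConst_pos d ρ)
  have hE : 0 ≤ errConst d r ρ (R + 1) A := by unfold errConst; positivity
  have hNτ : 0 ≤ N * τ := by positivity
  have hNB : 0 ≤ N * τ * incrBound (R + 1) := by positivity
  have hNℓ : 0 ≤ N * τ * phaseLip (R + 1) := by positivity
  have hle : ∀ n ≤ N, (n : ℝ) * τ ≤ N * τ := fun n hn => by gcongr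
  have hnB : ∀ n ≤ N, (n : ℝ) * τ * incrBound (R + 1) ≤ 1 := fun n hn =>
    (mul_le_mul_of_nonneg_right (hle n hn) hB).trans (by linarith)
  have hb : ∀ n ≤ N, ∀ j ≤ n, ‖(schemeSeq hc τ u₀ v₀ j).1‖ ≤ R + 1 ∧
      ‖(schemeSeq hc τ u₀ v₀ j).2‖ ≤ R + 1 ∧ ‖(lieSeq τ w₀ z₀ j).1‖ ≤ R + 1 ∧
      ‖(lieSeq τ w₀ z₀ j).2‖ ≤ R + 1 ∧ ‖(schemeSeq hc τ u₀' v₀' j).1‖ ≤ R + 1 ∧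
      ‖(schemeSeq hc τ u₀' v₀' j).2‖ ≤ R + 1 := by
    intro n hn j hj
    have b := hnB j (hj.trans hn)
    obtain ⟨x1, x2⟩ := norm_schemeSeq_le hc hτ.le hτ1 bu bv b
    obtain ⟨x3, x4⟩ := norm_lieSeq_le hτ.le hτ1 bw bz b
    obtain ⟨x5, x6⟩ := norm_schemeSeq_le hc hτ.le hτ1 bu' bv' b
    exact ⟨x1, x2, x3, x4, x5, x6⟩
  -- The sequences in `H^r` and `H^ρ` are the same distributions, so the `H^r` iterates inherit the
  -- `H^ρ` bounds.
  have hcoeff : ∀ j, coeff (schemeSeq hc τ u₀ v₀ j).1 = coeff (schemeSeq hc τ u₀' v₀' j).1 ∧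
      coeff (schemeSeq hc τ u₀ v₀ j).2 = coeff (schemeSeq hc τ u₀' v₀' j).2 := by
    intro j
    induction j with
    | zero => exact ⟨huu, hvv⟩
    | succ j ih => simp only [schemeSeq, coeff_propA_add_schemeIncr, ih, and_self]
  have hrec : ∀ n ≤ N, ‖(schemeSeq hc τ u₀ v₀ n).1 - (lieSeq τ w₀ z₀ n).1‖
      + ‖(schemeSeq hc τ u₀ v₀ n).2 - (lieSeq τ w₀ z₀ n).2‖
      ≤ 2 * (errConst d r ρ (R + 1) A * c ^ (-δ)) + 2 * phaseLip (R + 1) * τ *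
        ∑ j ∈ Finset.range n, (‖(schemeSeq hc τ u₀ v₀ j).1 - (lieSeq τ w₀ z₀ j).1‖
          + ‖(schemeSeq hc τ u₀ v₀ j).2 - (lieSeq τ w₀ z₀ j).2‖) := by
    intro n hn
    have hn1 : (n : ℝ) * τ ≤ 1 := (hle n hn).trans (by linarith)
    have e1 := component_error_le (u := fun j => (schemeSeq hc τ u₀ v₀ j).1)
      (v := fun j => (schemeSeq hc τ u₀ v₀ j).2) (w := fun j => (lieSeq τ w₀ z₀ j).1)
      (z := fun j => (lieSeq τ w₀ z₀ j).2) (u' := fun j => (schemeSeq hc τ u₀' v₀' j).1)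
      (v' := fun j => (schemeSeq hc τ u₀' v₀' j).2) h hc hδ hδ2 hτ hτ1 hstep hn1 (fun j => (hcoeff j).1)
      (fun j => (hcoeff j).2) (hb n hn) (fun _ => rfl) (fun _ => rfl) hu0
    have e2 := component_error_le (u := fun j => (schemeSeq hc τ u₀ v₀ j).2)
      (v := fun j => (schemeSeq hc τ u₀ v₀ j).1) (w := fun j => (lieSeq τ w₀ z₀ j).2)
      (z := fun j => (lieSeq τ w₀ z₀ j).1) (u' := fun j => (schemeSeq hc τ u₀' v₀' j).2)
      (v' := fun j => (schemeSeq hc τ u₀' v₀' j).1) h hc hδ hδ2 hτ hτ1 hstep hn1 (fun j => (hcoeff j).2)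
      (fun j => (hcoeff j).1) (fun j hj => by
        obtain ⟨x1, x2, x3, x4, x5, x6⟩ := hb n hn j hj
        exact ⟨x2, x1, x4, x3, x6, x5⟩) (fun _ => rfl) (fun _ => rfl) hv0
    simp only [add_comm ‖(schemeSeq hc τ u₀ v₀ _).2 - (lieSeq τ w₀ z₀ _).2‖] at e2
    linarith
  -- Adding the two components doubles both constants; Gronwall doubles again, whence `4 * errConst`
  -- and the `4 * phaseLip` in `hN`.
  have := le_of_discrete_gronwall (by positivity) hτ.le (by positivity)
    (by linarith : 2 * (2 * phaseLip (R + 1) * (N * τ)) ≤ 1) hrec N le_rfl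
  linarith

end Convergence

end Sob

end KleinGordon
end

/-! ### Initial data and conclusion -/

noncomputable section

namespace KleinGordon

variable {d : ℕ}

lemma sobolevNorm_mono {r ρ : ℝ} (h : r ≤ ρ) (a : PerDist d) :
    sobolevNorm r a ≤ sobolevNorm ρ a := by
  have := sobolevNorm_multiplier_le (r := r) (ρ := ρ) (m := fun _ => 1) zero_le_one (fun k => by
    have := weight_mul_rpow_le (r := r) (ρ := ρ) (δ := 0) (by linarith) k
    simpa using this) a
  have e : multiplier (fun _ => 1) a = a := by ext k; simp [multiplier]
  simpa [e] using this

lemma conjDist_invCBracket (c : ℝ) (a : PerDist d) :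
    conjDist (invCBracket c a) = invCBracket c (conjDist a) := by
  ext k
  simp only [conjDist, invCBracket, multiplier, map_mul, Complex.conj_ofReal, bracket, freqSq_neg]

namespace Sob

variable {s : ℝ}

/-- The maximum covers negative `b`, which `ENNReal.ofReal` sends to `0`. -/
lemma norm_add_norm_le {x y : Sob d s} {b : ℝ}
    (h : sobolevNorm s (coeff x) + sobolevNorm s (coeff y) ≤ ENNReal.ofReal b) :
    ‖x‖ + ‖y‖ ≤ algConst d s * max b 0 := by
  have hp := algConst_pos d s
  have h' := h.trans (ENNReal.ofReal_le_ofReal (le_max_left b 0))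
  rw [sobolevNorm_coeff, sobolevNorm_coeff, ← ENNReal.ofReal_add (by positivity) (by positivity),
    ENNReal.ofReal_le_ofReal_iff (le_max_right _ _), ← add_div, div_le_iff₀ hp] at h'
  linarith

/-- The first component of the data, in terms of `z(0)` and `c⁻¹⟨∇⟩_c⁻¹ ∂ₜz(0)`. -/
def dataU (x y : Sob d s) : Sob d s := x - Complex.I • y

/-- The second component of the data. -/
def dataV (x y : Sob d s) : Sob d s := star x - Complex.I • star y

lemma norm_dataU_le (x y : Sob d s) : ‖dataU x y‖ ≤ ‖x‖ + ‖y‖ := by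
  refine (norm_sub_le _ _).trans_eq ?_
  rw [norm_smul, Complex.norm_I, one_mul]

lemma norm_dataV_le (x y : Sob d s) : ‖dataV x y‖ ≤ ‖x‖ + ‖y‖ := by
  refine (norm_sub_le _ _).trans_eq ?_
  rw [norm_smul, Complex.norm_I, one_mul, norm_star, norm_star]

lemma dataU_sub_dataU (x y x' y' : Sob d s) :
    dataU x y - dataU x' y' = dataU (x - x') (y - y') := by
  simp only [dataU, smul_sub]; abel

lemma dataV_sub_dataV (x y x' y' : Sob d s) :
    dataV x y - dataV x' y' = dataV (x - x') (y - y') := by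
  simp only [dataV, smul_sub, star_sub]; abel

lemma coeff_dataU (x y : Sob d s) : coeff (dataU x y) = coeff x - Complex.I • coeff y := by
  rw [dataU, map_sub, map_smul]

lemma coeff_dataV (x y : Sob d s) :
    coeff (dataV x y) = conjDist (coeff x) - Complex.I • conjDist (coeff y) := by
  rw [dataV, map_sub, map_smul, coeff_star, coeff_star]

end Sob

end KleinGordon
end

open KleinGordon KleinGordon.Sob in
theorem lemma3p4 (d : ℕ) (r δ ε : ℝ) (hr : (d : ℝ) / 2 < r) (hδ : 0 < δ) (hδ2 : δ ≤ 2)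
    (hε : 0 < ε) (M K : ℝ) :
    ∃ T : ℝ, 0 < T ∧ ∃ τ₀ : ℝ, 0 < τ₀ ∧ ∃ C : ℝ,
      ∀ c : ℝ, 0 < c → ∀ z0 z1 γ φ : KleinGordon.PerDist d,
        KleinGordon.sobolevNorm (r + 2 * δ + ε) z0
            + KleinGordon.sobolevNorm (r + 2 * δ + ε) (KleinGordon.invCBracket c z1)
          ≤ ENNReal.ofReal M →
        KleinGordon.sobolevNorm r (z0 - γ)
            + KleinGordon.sobolevNorm r (KleinGordon.invCBracket c z1 - φ)
          ≤ ENNReal.ofReal (K * c ^ (-δ)) →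
        ∀ τ : ℝ, 0 < τ → τ ≤ τ₀ → 1 ≤ τ * c ^ (2 - δ) →
          ∀ n : ℕ, (n : ℝ) * τ ≤ T →
            KleinGordon.sobolevNorm r
                ((KleinGordon.scheme c τ z0 z1 n).1 - (KleinGordon.lie τ γ φ n).1)
              + KleinGordon.sobolevNorm r
                ((KleinGordon.scheme c τ z0 z1 n).2 - (KleinGordon.lie τ γ φ n).2)
            ≤ ENNReal.ofReal (C * c ^ (-δ)) := by
  set ρ := r + 2 * δ + ε with hρdef
  have hrρ : r ≤ ρ := by linarith
  have : Fact ((d : ℝ) / 2 < r) := ⟨hr⟩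
  have : Fact ((d : ℝ) / 2 < ρ) := ⟨hr.trans_le hrρ⟩
  have hκr := algConst_pos d r
  have hκρ := algConst_pos d ρ
  have hM : 0 ≤ max M 0 := le_max_right _ _
  have hK : 0 ≤ max K 0 := le_max_right _ _
  -- One radius for the scheme's data in both spaces and for the limit data in `H^r`.
  set R := (algConst d r + algConst d ρ) * (max M 0 + max K 0) with hRdef
  have hR : 0 ≤ R := by positivity
  have hB : 0 ≤ incrBound (R + 1) := by unfold incrBound; positivity
  have hℓ : 0 ≤ phaseLip (R + 1) := by unfold phaseLip; positivity
  have hden : 0 < 1 + incrBound (R + 1) + 4 * phaseLip (R + 1) := by positivity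
  -- The summands of `1/T` ensure `t_n ≤ 1`, boundedness by `R + 1`, and smallness for Gronwall. The
  -- choice `τ₀ = 1/2` forces `c ≥ 1`, hence `c^{-δ} ≤ 1`, so the limit data are bounded uniformly
  -- in `c`. Dividing by `algConst d r` undoes the rescaling of the norm.
  refine ⟨(1 + incrBound (R + 1) + 4 * phaseLip (R + 1))⁻¹, inv_pos.2 hden, 1 / 2, by norm_num,
    4 * errConst d r ρ (R + 1) (algConst d r * max K 0) / algConst d r,
    fun c hc z0 z1 γ φ hdata hlim τ hτ hτ2 hstep n hn => ?_⟩
  have hc1 := one_le_of_step_bound hc hδ2 hτ hτ2 hstep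
  have hη : 0 ≤ c ^ (-δ) := Real.rpow_nonneg hc.le _
  have hη1 : c ^ (-δ) ≤ 1 := Real.rpow_le_one_of_one_le_of_nonpos hc1 (by linarith)
  have hz : sobolevNorm ρ z0 ≠ ⊤ := ((le_self_add.trans hdata).trans_lt ENNReal.ofReal_lt_top).ne
  have hy : sobolevNorm ρ (invCBracket c z1) ≠ ⊤ :=
    ((le_add_self.trans hdata).trans_lt ENNReal.ofReal_lt_top).ne
  have hdz : sobolevNorm r (z0 - γ) ≠ ⊤ :=
    ((le_self_add.trans hlim).trans_lt ENNReal.ofReal_lt_top).ne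
  have hdy : sobolevNorm r (invCBracket c z1 - φ) ≠ ⊤ :=
    ((le_add_self.trans hlim).trans_lt ENNReal.ofReal_lt_top).ne
  obtain ⟨Z', hZ'⟩ := exists_coeff_eq hz
  obtain ⟨Y', hY'⟩ := exists_coeff_eq hy
  obtain ⟨Z, hZ⟩ := exists_coeff_eq ((sobolevNorm_mono hrρ z0).trans_lt hz.lt_top).ne
  obtain ⟨Y, hY⟩ := exists_coeff_eq
    ((sobolevNorm_mono hrρ (invCBracket c z1)).trans_lt hy.lt_top).ne
  -- Only the differences are assumed to be in `H^r`; `γ` and `φ` are recovered as `Z - P` and `Y -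
  -- Q`.
  obtain ⟨P, hP⟩ := exists_coeff_eq hdz
  obtain ⟨Q, hQ⟩ := exists_coeff_eq hdy
  have bρ : ‖Z'‖ + ‖Y'‖ ≤ algConst d ρ * max M 0 := norm_add_norm_le (by rwa [hZ', hY'])
  have br : ‖Z‖ + ‖Y‖ ≤ algConst d r * max M 0 := norm_add_norm_le (by
    rw [hZ, hY]
    exact (add_le_add (sobolevNorm_mono hrρ _) (sobolevNorm_mono hrρ _)).trans hdata)
  have bd : ‖P‖ + ‖Q‖ ≤ algConst d r * max K 0 * c ^ (-δ) := by
    refine (norm_add_norm_le (by rwa [hP, hQ])).trans_eq ?_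
    rw [mul_assoc, max_mul_of_nonneg _ _ hη, zero_mul]
  have bd1 : ‖P‖ + ‖Q‖ ≤ algConst d r * max K 0 :=
    bd.trans (mul_le_of_le_one_right (by positivity) hη1)
  have e : ∀ x y : Sob d r, x - (x - y) = y := fun x y => by abel
  have bR : algConst d r * max M 0 + algConst d r * max K 0 ≤ R := by
    have : 0 ≤ algConst d ρ * (max M 0 + max K 0) := by positivity
    rw [hRdef]; linarith
  have bRρ : algConst d ρ * max M 0 ≤ R := by
    have : 0 ≤ algConst d ρ * max K 0 := by positivity
    have : 0 ≤ algConst d r * (max M 0 + max K 0) := by positivity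
    rw [hRdef]; linarith
  have bRr : algConst d r * max M 0 ≤ R := by
    have : 0 ≤ algConst d r * max K 0 := by positivity
    linarith
  have bL : ‖Z - P‖ + ‖Y - Q‖ ≤ R := by
    have := norm_sub_le Z P
    have := norm_sub_le Y Q
    linarith
  have hN : n * τ * (1 + incrBound (R + 1) + 4 * phaseLip (R + 1)) ≤ 1 := by
    rwa [← le_div_iff₀ hden, one_div]
  have main := error_le (r := r) (ρ := ρ) (by linarith) hc hδ hδ2 hτ (by linarith) hstep hR
    (A := algConst d r * max K 0) (by positivity)
    (u₀ := dataU Z Y) (v₀ := dataV Z Y) (w₀ := dataU (Z - P) (Y - Q)) (z₀ := dataV (Z - P) (Y - Q))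
    (u₀' := dataU Z' Y') (v₀' := dataV Z' Y')
    (by rw [coeff_dataU, coeff_dataU, hZ, hY, hZ', hY'])
    (by rw [coeff_dataV, coeff_dataV, hZ, hY, hZ', hY'])
    ((norm_dataU_le _ _).trans (br.trans bRr)) ((norm_dataV_le _ _).trans (br.trans bRr))
    ((norm_dataU_le _ _).trans bL) ((norm_dataV_le _ _).trans bL)
    ((norm_dataU_le _ _).trans (bρ.trans bRρ)) ((norm_dataV_le _ _).trans (bρ.trans bRρ))
    (by rw [dataU_sub_dataU, e, e]; exact (norm_dataU_le _ _).trans bd)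
    (by rw [dataV_sub_dataV, e, e]; exact (norm_dataV_le _ _).trans bd) hN
  have cs := coeff_schemeSeq (τ := τ) hc (z0 := z0) (z1 := z1) (u₀ := dataU Z Y) (v₀ := dataV Z Y)
    (by rw [coeff_dataU, hZ, hY]; rfl)
    (by rw [coeff_dataV, hZ, hY, conjDist_invCBracket]; rfl) n
  have hγ : coeff (Z - P) = γ := by rw [map_sub, hZ, hP, sub_sub_cancel]
  have hφ : coeff (Y - Q) = φ := by rw [map_sub, hY, hQ, sub_sub_cancel]
  have cl := coeff_lieSeq (τ := τ) (γ := γ) (φ := φ) (u₀ := dataU (Z - P) (Y - Q))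
    (v₀ := dataV (Z - P) (Y - Q)) (by rw [coeff_dataU, hγ, hφ]; rfl)
    (by rw [coeff_dataV, hγ, hφ]; rfl) n
  rw [← cs.1, ← cs.2, ← cl.1, ← cl.2, ← map_sub, ← map_sub, sobolevNorm_coeff, sobolevNorm_coeff,
    ← ENNReal.ofReal_add (by positivity) (by positivity), ← add_div]
  refine ENNReal.ofReal_le_ofReal ?_
  rw [div_mul_eq_mul_div]
  gcongr
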